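/- **Theorem 2.1.** Let $Q(\zeta)=|\zeta|^2$ and $dA=\pi^{-1}d^2\zeta$ on $\mathbb C$. For $N\ge 1$ consider the symplectic Ginibre ensemble, i.e. $N$ particles in $\mathbb C$ with joint density $$\frac1{Z_N}\prod_{j<l}|\zeta_j-\zeta_l|^2|\zeta_j-\bar\zeta_l|^2\prod_{j=1}^N|\zeta_j-\bar\zeta_j|^2e^{-NQ(\zeta_j)}=:\frac1{Z_N}e^{-\mathbf H_N(\zeta_1,\dots,\zeta_N)}$$ with respect to $\prod_j dA(\zeta_j)$, where $Z_N$ is the normalising constant, and its $k$-point correlation functions ($k\le N$) $$\mathbf R_{N,k}(\zeta_1,\dots,\zeta_k)=\frac{1}{Z_N}\frac{N!}{(N-k)!}\int_{\mathbb C^{N-k}}e^{-\mathbf H_N(\zeta_1,\dots,\zeta_N)}\prod_{j=k+1}^N dA(\zeta_j).$$ Let $p\in\{\sqrt2,-\sqrt2\}$, let $e^{i\theta}=p/\sqrt2$ be the outer unit normal at $p$ to the disc of radius $\sqrt2$ centred at $0$, and let $r_N>0$ be the micro-scale at $p$, defined by $\int_{|\zeta-p|<r_N}\tfrac12\partial\bar\partial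 Q\,dA=\tfrac1N$ (so $r_N=\sqrt{2/N}$). Put $$R_{N,k}(z_1,\dots,z_k)=r_N^{2k}\,\mathbf R_{N,k}\big(p+e^{i\theta}r_Nz_1,\dots,p+e^{i\theta}r_Nz_k\big).$$ Then for every $k$, as $N\to\infty$, $R_{N,k}(z_1,\dots,z_k)$ converges, uniformly for $(z_1,\dots,z_k)$ in compact subsets of $\mathbb C^k$, to $$R_k(z_1,\dots,z_k)=\prod_{j=1}^k(\bar z_j-z_j)\,\operatorname{Pf}\big[K^{\mathbb R}_{\rm edge}(z_j,z_l)\big]_{j,l=1}^k,$$ where $\operatorname{Pf}$ is the Pfaffian of the $2k\times2k$ skew-symmetric matrix built from the $2\times 2$ blocks $$K^{\mathbb R}_{\rm edge}(z,w)=e^{-|z|^2-|w|^2}\begin{pmatrix}\kappa(z,w)&\kappa(z,\bar w)\\ \kappa(\bar z,w)&\kappa(\bar z,\bar w)\end{pmatrix},\qquad \kappa(z,w)=\sqrt\pi\,e^{z^2+w^2}\int_{-\infty}^0W(f_w,f_z)(u)\,du,$$ $f_z(u)=\tfrac12\operatorname{erfc}\big(\sqrt2(z-u)\big)$ with $\operatorname{erfc}(z)=1-\tfrac{2}{\sqrt\pi}\int_0^ze^{-s^2}ds$,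 and $W(f,g)=fg'-f'g$ is the Wronskian; the integral defining $\kappa(z,w)$ converges absolutely for all $z,w\in\mathbb C$. -/

import Mathlib

open MeasureTheory Filter Topology
open scoped NNReal ComplexConjugate

noncomputable section

namespace SymplecticGinibre

/-- The measure `dA = π⁻¹ d²ζ` on the complex plane. -/
def areaMeasure : Measure ℂ := NNReal.pi⁻¹ • (volume : Measure ℂ)

/-- The operator `∂ ∂̄`, i.e. one quarter of the usual Laplacian. -/
def quarterLaplacian (Q : ℂ → ℝ) (ζ : ℂ) : ℝ := (1 / 4) * Laplacian.laplacian Q ζ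

/-- `r` is the micro-scale at `p`: `∫_{𝔻(p,r)} (∂∂̄Q)/2 dA = 1/N`. -/
def IsMicroScale (Q : ℂ → ℝ) (p : ℂ) (N : ℕ) (r : ℝ) : Prop :=
  0 < r ∧ ∫ ζ in Metric.ball p r, quarterLaplacian Q ζ / 2 ∂areaMeasure = 1 / (N : ℝ)

/-- The Boltzmann weight `exp (- H_N)` of a configuration `ζ` of particles indexed by `ι`, where
`H_N(ζ) = ∑_{j ≠ l} log (1 / (|ζ_j - ζ_l| |ζ_j - conj ζ_l|))
  + ∑_j (log (1 / |ζ_j - conj ζ_j|²) + N Q(ζ_j))`.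
It is written multiplicatively so that it vanishes where `H_N = +∞`. The product over `j ≠ l` runs
over ordered pairs. -/
def boltzmann (Q : ℂ → ℝ) (N : ℕ) {ι : Type*} [Fintype ι] [DecidableEq ι] (ζ : ι → ℂ) : ℝ :=
  (∏ q ∈ (Finset.univ : Finset ι).offDiag, ‖ζ q.1 - ζ q.2‖ * ‖ζ q.1 - conj (ζ q.2)‖) *
    ∏ j, ‖ζ j - conj (ζ j)‖ ^ 2 * Real.exp (-(N * Q (ζ j)))

/-- The partition function `Z_N`. -/
def partitionFunction (Q : ℂ → ℝ) (N : ℕ) : ℝ :=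
  ∫ ζ : Fin N → ℂ, boltzmann Q N ζ ∂(Measure.pi fun _ => areaMeasure)

/-- The (unscaled) `k`-point correlation function of the `N`-particle system: `N! / (N - k)! / Z_N`
times the integral of the Boltzmann weight over the last `N - k` particles, the first `k` being
held fixed at `ζ`. The descending factorial makes it `0` for `k > N`. -/
def correlation (Q : ℂ → ℝ) (N k : ℕ) (ζ : Fin k → ℂ) : ℝ :=
  (partitionFunction Q N)⁻¹ * (N.descFactorial k : ℝ) *
    ∫ η : Fin (N - k) → ℂ, boltzmann Q N (Sum.elim ζ η) ∂(Measure.pi fun _ => areaMeasure)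

/-- The `k`-point correlation function of the process rescaled at `p` with scale `r` and direction
`e^{iθ}`, that is, of the points `z_j = e^{-iθ} r⁻¹ (ζ_j - p)`. -/
def rescaledCorrelation (Q : ℂ → ℝ) (p : ℂ) (θ r : ℝ) (N k : ℕ) (z : Fin k → ℂ) : ℝ :=
  r ^ (2 * k) * correlation Q N k fun j => p + Complex.exp (θ * Complex.I) * r * z j

/-- The Gaussian potential. -/
def gaussianPotential (ζ : ℂ) : ℝ := ‖ζ‖ ^ 2

/-- The Pfaffian of a skew-symmetric matrix with rows and columns
`(1,0), (1,1), (2,0), (2,1), …, (k,0), (k,1)`, as a sum over permutations. -/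
def pfaffian {k : ℕ} (A : Matrix (Fin k × Fin 2) (Fin k × Fin 2) ℂ) : ℂ :=
  (1 / ((2 : ℂ) ^ k * (k.factorial : ℂ))) *
    ∑ σ : Equiv.Perm (Fin k × Fin 2),
      ((Equiv.Perm.sign σ : ℤ) : ℂ) * ∏ j : Fin k, A (σ (j, 0)) (σ (j, 1))

/-- The entire complementary error function
`erfc z = 1 - (2 / √π) ∫_0^z e^{-s²} ds`, the integral being taken along the segment. -/
def erfc (z : ℂ) : ℂ :=
  1 - 2 / (Real.sqrt Real.pi : ℂ) * ∫ t in (0 : ℝ)..1, z * Complex.exp (-((t : ℂ) * z) ^ 2)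

/-- The Wronskian `W(f, g) = f g' - f' g`. -/
def wronskian (f g : ℝ → ℂ) (u : ℝ) : ℂ := f u * deriv g u - deriv f u * g u

/-- `f_z(u) = erfc(√2 (z - u)) / 2`. -/
def edgeFun (z : ℂ) (u : ℝ) : ℂ := (1 / 2) * erfc ((Real.sqrt 2 : ℂ) * (z - u))

/-- The edge pre-kernel `√π e^{z² + w²} ∫_{-∞}^0 W(f_w, f_z)(u) du`. -/
def edgePreKernel (z w : ℂ) : ℂ :=
  (Real.sqrt Real.pi : ℂ) * Complex.exp (z ^ 2 + w ^ 2) *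
    ∫ u in Set.Iio (0 : ℝ), wronskian (edgeFun w) (edgeFun z) u

/-- The `2 × 2` matrix kernel
`e^{-|z|² - |w|²} [[κ(z, w), κ(z, conj w)], [κ(conj z, w), κ(conj z, conj w)]]`. -/
def edgeKernel (z w : ℂ) : Matrix (Fin 2) (Fin 2) ℂ :=
  Complex.exp (-(‖z‖ : ℂ) ^ 2 - (‖w‖ : ℂ) ^ 2) •
    !![edgePreKernel z w, edgePreKernel z (conj w);
       edgePreKernel (conj z) w, edgePreKernel (conj z) (conj w)]

/-- The limiting correlation function
`∏_j (conj z_j - z_j) · Pf [K(z_j, z_l)]_{j,l}`. -/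
def edgeCorrelation (k : ℕ) (z : Fin k → ℂ) : ℂ :=
  (∏ j, (conj (z j) - z j)) *
    pfaffian (Matrix.of fun a b => edgeKernel (z a.1) (z b.1) a.2 b.2)

end SymplecticGinibre

end

open SymplecticGinibre

/-!
Let `x` run over the points `ζ₁, conj ζ₁, …, ζ_N, conj ζ_N`. The Boltzmann weight is the Vandermonde
determinant of these `2 N` points times `∏ (ζ_j - conj ζ_j) e^{-N |ζ_j|²}` (`boltzmann_eq_det`), and
the powers in that determinant may be replaced by monic polynomials that are skew-orthogonal for
`⟨P, Q⟩ = ∫ P(ζ) Q(conj ζ) (ζ - conj ζ) e^{-N |ζ|²} dA`. These are `ζ^{2 i + 1}` and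
`∑_{l ≤ i} (2 / N)^{i - l} (i! / l!) ζ^{2 l}`, with skew norms `(2 i + 1)! / N^{2 i + 2}`.
Expanding the determinant and integrating over `N - k` particles leaves a signed sum in which every
integrated pair of points carries the two polynomials of one skew-orthogonal pair
(`sum_sign_partial_pairing`). The same sum is obtained by expanding the Pfaffian of the
skew-symmetric kernel `∑ (P_{2i}(x) P_{2i+1}(y) - P_{2i+1}(x) P_{2i}(y)) / r_i` multilinearly
(`pfaffian_sum_wedge`), so that the correlation functions are Pfaffians (`correlation_eq_pfaffian`).

At the edge the points are `± r_N (√N + z)`. Put `a = √N + z`, `b = √N + w`. Up to factors that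
cancel in the Pfaffian (`rescaledCorrelation_eq`) the rescaled kernel is
`Ψ_N(z, w) = 2 e^{-a²-b²} ∑_{i < N} 4^i i! / (2i+1)! (a^{2i+1} e_{i+1}(b²) - b^{2i+1} e_{i+1}(a²))`
with truncated exponentials `e_n`. Its derivative along the diagonal direction
`(z, w) ↦ (z + s, w + s)` telescopes to the Wronskian-type expression
`2 · 4^N N! / (2N)! · e^{-a² - b²} (b^{2N} e_N(a²) - a^{2N} e_N(b²))` (`hasDerivAt_skewSum`).
Since `Ψ_N` vanishes at `s = +∞`, it is minus the integral of this expression over `s > 0`.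
Expanding the logarithm to second order, `a^{2N} e^{-a²}`, divided by `N^N e^{-N}`, tends to
`e^{-2 z²}`; the remaining constants converge by Stirling's formula, and `e^{-a²} e_N(a²)`, whose
derivative is of the same type, tends to `erfc(√2 z) / 2`. The elementary inequality
`x ≤ e^{x - 1}` gives bounds that are uniform in `N` and exponentially small in `s`
(`norm_edgePower_le`), so that dominated convergence applies (`tendsto_scaledPreKernel`). In the
limit the integrand is the Wronskian of `f_w` and `f_z` at `u = -s`.

These limits are taken along a countably generated filter, with varying `z` and `w`. Applied to
`atTop ×ˢ 𝓝 z` this gives continuous convergence of the correlation functions, which implies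
uniform convergence on compact sets (`tendstoUniformlyOn_of_continuousConvergence`).
-/

namespace SymplecticGinibre

/-! ### Signed sums over permutations of paired indices -/

section Combinatorics

open Equiv

variable {J : Type*} [Fintype J] [DecidableEq J]

/-- Exchanging the two members of the pair `t` changes the sign of a permutation, so that
antisymmetrising the factor of that pair doubles a signed sum. -/
theorem sum_sign_antisymm_one (t : J) (V : J → J × Fin 2 → J × Fin 2 → ℂ) :
    ∑ σ : Perm (J × Fin 2), ((Perm.sign σ : ℤ) : ℂ) *
      ∏ j, (if j = t then V j (σ (j, 0)) (σ (j, 1)) - V j (σ (j, 1)) (σ (j, 0))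
        else V j (σ (j, 0)) (σ (j, 1))) =
    2 * ∑ σ : Perm (J × Fin 2), ((Perm.sign σ : ℤ) : ℂ) * ∏ j, V j (σ (j, 0)) (σ (j, 1)) := by
  set s : Perm (J × Fin 2) := swap (t, 0) (t, 1) with hs
  have hne : ((t, 0) : J × Fin 2) ≠ (t, 1) := by simp
  have hfix : ∀ j, j ≠ t → ∀ b : Fin 2, s (j, b) = (j, b) := fun j hj b =>
    swap_apply_of_ne_of_ne (by simp [hj]) (by simp [hj])
  have hexp : ∀ σ : Perm (J × Fin 2),
      ∏ j, (if j = t then V j (σ (j, 0)) (σ (j, 1)) - V j (σ (j, 1)) (σ (j, 0))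
        else V j (σ (j, 0)) (σ (j, 1))) =
      ∏ j, V j (σ (j, 0)) (σ (j, 1)) - ∏ j, V j ((σ * s) (j, 0)) ((σ * s) (j, 1)) := by
    intro σ
    rw [Fintype.prod_eq_mul_prod_compl t, Fintype.prod_eq_mul_prod_compl t (fun j => V j _ _),
      Fintype.prod_eq_mul_prod_compl t (fun j => V j ((σ * s) (j, 0)) _)]
    have h1 : ∏ j ∈ ({t}ᶜ : Finset J),
        (if j = t then V j (σ (j, 0)) (σ (j, 1)) - V j (σ (j, 1)) (σ (j, 0))
        else V j (σ (j, 0)) (σ (j, 1))) = ∏ j ∈ ({t}ᶜ : Finset J), V j (σ (j, 0)) (σ (j, 1)) :=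
      Finset.prod_congr rfl fun j hj => if_neg (by simpa using hj)
    have h2 : ∏ j ∈ ({t}ᶜ : Finset J), V j ((σ * s) (j, 0)) ((σ * s) (j, 1)) =
        ∏ j ∈ ({t}ᶜ : Finset J), V j (σ (j, 0)) (σ (j, 1)) :=
      Finset.prod_congr rfl fun j hj => by
        have hj' : j ≠ t := by simpa using hj
        simp only [Perm.mul_apply, hfix j hj']
    rw [h1, h2, if_pos rfl, Perm.mul_apply, Perm.mul_apply, hs, swap_apply_left, swap_apply_right]
    ring
  have hflip : ∑ σ : Perm (J × Fin 2), ((Perm.sign σ : ℤ) : ℂ) *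
      ∏ j, V j ((σ * s) (j, 0)) ((σ * s) (j, 1)) =
      -∑ σ : Perm (J × Fin 2), ((Perm.sign σ : ℤ) : ℂ) * ∏ j, V j (σ (j, 0)) (σ (j, 1)) := by
    rw [← Equiv.sum_comp (Equiv.mulRight s) fun σ : Perm (J × Fin 2) =>
      ((Perm.sign σ : ℤ) : ℂ) * ∏ j, V j (σ (j, 0)) (σ (j, 1)), ← Finset.sum_neg_distrib]
    refine Finset.sum_congr rfl fun σ _ => ?_
    rw [Equiv.coe_mulRight, Perm.sign_mul, hs, Perm.sign_swap hne]
    push_cast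
    ring
  simp only [hexp, mul_sub, Finset.sum_sub_distrib]
  rw [hflip]
  ring

theorem sum_sign_antisymm (T : Finset J) (V : J → J × Fin 2 → J × Fin 2 → ℂ) :
    ∑ σ : Perm (J × Fin 2), ((Perm.sign σ : ℤ) : ℂ) *
      ∏ j, (if j ∈ T then V j (σ (j, 0)) (σ (j, 1)) - V j (σ (j, 1)) (σ (j, 0))
        else V j (σ (j, 0)) (σ (j, 1))) =
    2 ^ T.card *
      ∑ σ : Perm (J × Fin 2), ((Perm.sign σ : ℤ) : ℂ) * ∏ j, V j (σ (j, 0)) (σ (j, 1)) := by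
  induction T using Finset.induction_on with
  | empty => simp
  | insert t T ht ih =>
    rw [Finset.card_insert_of_notMem ht, pow_succ', mul_assoc, ← ih,
      ← sum_sign_antisymm_one t fun j a b => if j ∈ T then V j a b - V j b a else V j a b]
    refine Finset.sum_congr rfl fun σ _ => ?_
    congr 1
    refine Finset.prod_congr rfl fun j _ => ?_
    by_cases hj : j = t
    · subst hj; simp [ht]
    · simp [hj]

theorem sum_sign_prod_sum {I : Type*} [Fintype I] {β : Type*} [Fintype β] [DecidableEq β]
    {G : Type*} [Fintype G] (c : G → ℂ) (W : β → I → G → ℂ) :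
    ∑ σ : G, c σ * ∏ j, ∑ i, W j i σ = ∑ f : β → I, ∑ σ : G, c σ * ∏ j, W j (f j) σ := by
  rw [Finset.sum_comm]
  refine Finset.sum_congr rfl fun σ _ => ?_
  rw [Finset.prod_univ_sum, Fintype.piFinset_univ, Finset.mul_sum]

theorem det_pairs (M : Matrix (J × Fin 2) (J × Fin 2) ℂ) :
    M.det = ∑ σ : Perm (J × Fin 2), ((Perm.sign σ : ℤ) : ℂ) *
      ∏ j, (M (σ (j, 0)) (j, 0) * M (σ (j, 1)) (j, 1)) := by
  rw [Matrix.det_apply']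
  simp only [Fintype.prod_prod_type, Fin.prod_univ_two]

/-- The Pfaffian analogue of the Cauchy-Binet formula, for a form of rank `2 |I|` that is given as
a sum of decomposable forms. The sum over all `f`, rather than over the subsets of size `k`,
produces the factor `1 / k!`; the maps `f` that are not injective contribute `0`. -/
theorem pfaffian_sum_wedge {k : ℕ} {I : Type*} [Fintype I] (ρ : I → ℂ)
    (w : I × Fin 2 → Fin k × Fin 2 → ℂ) :
    pfaffian (Matrix.of fun a b =>
        ∑ i, ρ i * (w (i, 0) a * w (i, 1) b - w (i, 0) b * w (i, 1) a)) =
      (1 / (k.factorial : ℂ)) * ∑ f : Fin k → I, (∏ j, ρ (f j)) *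
        (Matrix.of fun a (c : Fin k × Fin 2) => w (f c.1, c.2) a).det := by
  have h := sum_sign_antisymm (J := Fin k) Finset.univ
    fun _ a b => ∑ i, ρ i * (w (i, 0) a * w (i, 1) b)
  simp only [Finset.mem_univ, if_true, ← Finset.sum_sub_distrib, ← mul_sub, Finset.card_univ,
    Fintype.card_fin] at h
  rw [pfaffian]
  simp only [Matrix.of_apply]
  rw [h, sum_sign_prod_sum]
  have h2 : ∀ f : Fin k → I, (∏ j, ρ (f j)) *
        (Matrix.of fun a (c : Fin k × Fin 2) => w (f c.1, c.2) a).det =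
      ∑ σ : Perm (Fin k × Fin 2), ((Perm.sign σ : ℤ) : ℂ) *
        ∏ j, ρ (f j) * (w (f j, 0) (σ (j, 0)) * w (f j, 1) (σ (j, 1))) := by
    intro f
    rw [det_pairs, Finset.mul_sum]
    refine Finset.sum_congr rfl fun σ _ => ?_
    simp only [Matrix.of_apply, Finset.prod_mul_distrib]
    ring
  simp only [h2]
  have : (2 : ℂ) ^ k ≠ 0 := pow_ne_zero _ two_ne_zero
  have : (k.factorial : ℂ) ≠ 0 := Nat.cast_ne_zero.mpr k.factorial_ne_zero
  field_simp

end Combinatorics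

section Counting

open Equiv

variable {α β : Type*} [Fintype α] [DecidableEq α] [Fintype β] [DecidableEq β]

/-- A sum over permutations of `α ⊕ β` of a function of their restriction to `α`: an injection of
`α` has `|β|!` extensions to a permutation. -/
theorem sum_perm_comp_inl (h : (α → α ⊕ β) → ℂ) (h0 : ∀ f, ¬ Function.Injective f → h f = 0) :
    ∑ π : Perm (α ⊕ β), h (π ∘ Sum.inl) = ((Fintype.card β).factorial : ℂ) * ∑ f, h f := by
  classical
  have e1 : ∑ π : Perm (α ⊕ β), h (π ∘ Sum.inl) =
      ∑ p : (Σ f : α ↪ α ⊕ β, β ↪ ↥(Set.range f)ᶜ), h p.1 := by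
    refine Fintype.sum_equiv ((Equiv.embeddingEquivOfFinite (α ⊕ β)).symm.trans
      sumEmbeddingEquivSigmaEmbeddingRestricted) _ _ fun π => ?_
    rfl
  rw [e1, Fintype.sum_sigma]
  have e2 : ∀ f : α ↪ α ⊕ β, ∑ _y : β ↪ ↥(Set.range f)ᶜ, h f =
      ((Fintype.card β).factorial : ℂ) * h f := by
    intro f
    have hc : Fintype.card ↥(Set.range f)ᶜ = Fintype.card β := by
      rw [Fintype.card_compl_set, Set.card_range_of_injective f.injective, Fintype.card_sum]
      omega
    rw [Finset.sum_const, Finset.card_univ, Fintype.card_embedding_eq, hc, Nat.descFactorial_self,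
      nsmul_eq_mul]
  simp only [e2]
  rw [← Finset.mul_sum]
  congr 1
  rw [← Finset.sum_subset (Finset.subset_univ (Finset.univ.filter Function.Injective))
    (fun f _ hf => h0 f (by simpa using hf))]
  refine Finset.sum_bij (fun f _ => f) (by simp [Function.Embedding.injective]) (by simp) ?_
    (by simp)
  intro f hf
  exact ⟨⟨f, by simpa using hf⟩, by simp, rfl⟩

theorem sum_perm_comp_inr (h : (β → α ⊕ β) → ℂ) (h0 : ∀ f, ¬ Function.Injective f → h f = 0) :
    ∑ π : Perm (α ⊕ β), h (π ∘ Sum.inr) = ((Fintype.card α).factorial : ℂ) * ∑ f, h f := by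
  have key := sum_perm_comp_inl (α := β) (β := α) (fun f => h (Equiv.sumComm _ _ ∘ f)) (fun f hf =>
    h0 _ fun hi => hf hi.of_comp)
  have e1 : ∑ f : β → β ⊕ α, h (Equiv.sumComm _ _ ∘ f) = ∑ f, h f :=
    Fintype.sum_equiv (Equiv.arrowCongr (Equiv.refl β) (Equiv.sumComm β α)) _ _ fun f => rfl
  rw [e1] at key
  rw [← key]
  refine Fintype.sum_equiv (Equiv.permCongr (Equiv.sumComm α β)) _ _ fun π => ?_
  congr 1
  funext b
  simp [Equiv.permCongr_apply]

/-- If the last pairs of columns are coordinate vectors, the determinant is a minor: here the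
permutation `π` of the index pairs sends the pairs `β` to the coordinates that occur. -/
theorem det_coordinate_columns (Φ : (α ⊕ β) × Fin 2 → α × Fin 2 → ℂ) (π : Perm (α ⊕ β)) :
    (Matrix.of fun (a c : (α ⊕ β) × Fin 2) => Sum.elim (fun j => Φ a (j, c.2))
        (fun j => if a = (π (Sum.inr j), c.2) then 1 else 0) c.1).det =
      (Matrix.of fun (a c : α × Fin 2) => Φ (π (Sum.inl c.1), c.2) a).det := by
  set M : Matrix ((α ⊕ β) × Fin 2) ((α ⊕ β) × Fin 2) ℂ :=
    Matrix.of fun (a c : (α ⊕ β) × Fin 2) => Sum.elim (fun j => Φ a (j, c.2))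
        (fun j => if a = (π (Sum.inr j), c.2) then 1 else 0) c.1 with hM
  set e : (α ⊕ β) × Fin 2 ≃ (α × Fin 2) ⊕ (β × Fin 2) := Equiv.sumProdDistrib α β (Fin 2)
  set q : Perm ((α ⊕ β) × Fin 2) := Equiv.prodCongr π (Equiv.refl _)
  have hsq : Perm.sign q = 1 := by
    have : q = Equiv.prodCongrLeft (fun _ : Fin 2 => π) := by
      ext ⟨a, b⟩ <;> rfl
    rw [this, Perm.sign_prodCongrLeft, Fin.prod_univ_two, Int.units_mul_self]
  have h1 : M.det = (M.submatrix q id).det := by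
    rw [Matrix.det_permute, hsq]
    simp
  have h2 : (M.submatrix q id).submatrix e.symm e.symm =
      Matrix.fromBlocks (Matrix.of fun (a c : α × Fin 2) => Φ (π (Sum.inl a.1), a.2) c) 0
        (Matrix.of fun (a : β × Fin 2) (c : α × Fin 2) => Φ (π (Sum.inr a.1), a.2) c) 1 := by
    ext a c
    rcases a with ⟨a, s⟩ | ⟨a, s⟩ <;> rcases c with ⟨c, t⟩ | ⟨c, t⟩ <;>
      simp [M, q, e, Matrix.one_apply]
  rw [h1, ← Matrix.det_submatrix_equiv_self e.symm (M.submatrix q id), h2,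
    Matrix.det_fromBlocks_zero₁₂, Matrix.det_one, mul_one, ← Matrix.det_transpose]
  rfl

/-- The algebraic core of the integration of a Slater-type determinant over the pairs indexed by
`β`, when the skew-inner products `S` of the functions are in canonical form. -/
theorem sum_sign_partial_pairing (Φ : (α ⊕ β) × Fin 2 → α × Fin 2 → ℂ) (r : α ⊕ β → ℂ)
    (hr : ∀ i, r i ≠ 0) (S : (α ⊕ β) × Fin 2 → (α ⊕ β) × Fin 2 → ℂ)
    (hS : ∀ a b, S a b =
      (∑ i, r i * ((if a = (i, 0) then 1 else 0) * (if b = (i, 1) then 1 else 0))) -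
      ∑ i, r i * ((if b = (i, 0) then 1 else 0) * (if a = (i, 1) then 1 else 0))) :
    ((Fintype.card α).factorial : ℂ) * ∑ σ : Perm ((α ⊕ β) × Fin 2), ((Perm.sign σ : ℤ) : ℂ) *
      ((∏ j : α, Φ (σ (Sum.inl j, 0)) (j, 0) * Φ (σ (Sum.inl j, 1)) (j, 1)) *
        ∏ j : β, S (σ (Sum.inr j, 0)) (σ (Sum.inr j, 1))) =
    2 ^ Fintype.card β * ((Fintype.card β).factorial : ℂ) * (∏ i, r i) *
      ∑ g : α → α ⊕ β, (∏ j, (r (g j))⁻¹) *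
        (Matrix.of fun (a c : α × Fin 2) => Φ (g c.1, c.2) a).det := by
  set V : (α ⊕ β) → (α ⊕ β) × Fin 2 → (α ⊕ β) × Fin 2 → ℂ := fun J a b =>
    Sum.elim (fun j => Φ a (j, 0) * Φ b (j, 1)) (fun _ => ∑ i, r i *
      ((if a = (i, 0) then 1 else 0) * (if b = (i, 1) then 1 else 0))) J with hV
  have hmem : ∀ j : α, Sum.inl j ∉ Finset.univ.map (Function.Embedding.inr : β ↪ α ⊕ β) := by simp
  have hmem' : ∀ j : β, Sum.inr j ∈ Finset.univ.map (Function.Embedding.inr : β ↪ α ⊕ β) := by simp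
  have h := sum_sign_antisymm (Finset.univ.map (Function.Embedding.inr : β ↪ α ⊕ β)) V
  simp only [Fintype.prod_sum_type, hmem, hmem', if_true, if_false, hV, Sum.elim_inl, Sum.elim_inr,
    ← hS, Finset.card_map, Finset.card_univ] at h
  rw [h]
  set Mf : (β → α ⊕ β) → Matrix ((α ⊕ β) × Fin 2) ((α ⊕ β) × Fin 2) ℂ := fun f =>
    Matrix.of fun a c => Sum.elim (fun j => Φ a (j, c.2))
        (fun j => if a = (f j, c.2) then 1 else 0) c.1 with hMf
  have hexp : ∑ σ : Perm ((α ⊕ β) × Fin 2), ((Perm.sign σ : ℤ) : ℂ) *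
      ((∏ j : α, Φ (σ (Sum.inl j, 0)) (j, 0) * Φ (σ (Sum.inl j, 1)) (j, 1)) *
        ∏ _j : β, ∑ i, r i * ((if σ (Sum.inr _j, 0) = (i, 0) then 1 else 0) *
          (if σ (Sum.inr _j, 1) = (i, 1) then 1 else 0))) =
      ∑ f : β → α ⊕ β, (∏ j, r (f j)) * (Mf f).det := by
    simp only [← mul_assoc (_ : ℂ) (∏ j : α, _) _]
    rw [sum_sign_prod_sum]
    refine Finset.sum_congr rfl fun f _ => ?_
    rw [det_pairs, Finset.mul_sum]
    refine Finset.sum_congr rfl fun σ _ => ?_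
    simp only [hMf, Matrix.of_apply, Fintype.prod_sum_type, Sum.elim_inl, Sum.elim_inr,
      Finset.prod_mul_distrib]
    ring
  have hzero : ∀ f : β → α ⊕ β, ¬ Function.Injective f → (∏ j, r (f j)) * (Mf f).det = 0 := by
    intro f hf
    simp only [Function.Injective, not_forall] at hf
    obtain ⟨i, j, hij, hne⟩ := hf
    rw [Matrix.det_zero_of_column_eq (i := (Sum.inr i, 0)) (j := (Sum.inr j, 0)), mul_zero]
    · simpa using hne
    · intro a
      simp [hMf, hij]
  have hzero' : ∀ g : α → α ⊕ β, ¬ Function.Injective g → (∏ j, (r (g j))⁻¹) *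
        (Matrix.of fun (a c : α × Fin 2) => Φ (g c.1, c.2) a).det = 0 := by
    intro f hf
    simp only [Function.Injective, not_forall] at hf
    obtain ⟨i, j, hij, hne⟩ := hf
    rw [Matrix.det_zero_of_column_eq (i := (i, 0)) (j := (j, 0)), mul_zero]
    · simpa using hne
    · intro a
      simp [hij]
  have hA := sum_perm_comp_inr (α := α) (β := β) _ hzero
  have hB := sum_perm_comp_inl (α := α) (β := β) _ hzero'
  have hAB : ∑ π : Perm (α ⊕ β), (∏ j, r ((π ∘ Sum.inr) j)) * (Mf (π ∘ Sum.inr)).det =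
      (∏ i, r i) * ∑ π : Perm (α ⊕ β), (∏ j, (r ((π ∘ Sum.inl) j))⁻¹) *
        (Matrix.of fun (a c : α × Fin 2) => Φ ((π ∘ Sum.inl) c.1, c.2) a).det := by
    rw [Finset.mul_sum]
    refine Finset.sum_congr rfl fun π _ => ?_
    have hd := det_coordinate_columns Φ π
    simp only [hMf, Function.comp_apply]
    rw [hd, ← Equiv.prod_comp π r, Fintype.prod_sum_type, Finset.prod_inv_distrib]
    have : ∏ j : α, r (π (Sum.inl j)) ≠ 0 := Finset.prod_ne_zero_iff.mpr fun j _ => hr _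
    field_simp
  rw [hexp, mul_left_comm, ← hA, hAB, hB]
  ring

end Counting

/-! ### The Boltzmann weight as a determinant -/

section Vandermonde

/-- The points of a configuration together with their complex conjugates. -/
def conjPairs {ι : Type*} (ζ : ι → ℂ) (a : ι × Fin 2) : ℂ :=
  if a.2 = 0 then ζ a.1 else conj (ζ a.1)

@[simp] theorem conjPairs_zero {ι : Type*} (ζ : ι → ℂ) (j : ι) : conjPairs ζ (j, 0) = ζ j := by
  simp [conjPairs]

@[simp] theorem conjPairs_one {ι : Type*} (ζ : ι → ℂ) (j : ι) :
    conjPairs ζ (j, 1) = conj (ζ j) := by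
  simp [conjPairs]

theorem boltzmann_comp_equiv {ι κ : Type*} [Fintype ι] [DecidableEq ι] [Fintype κ] [DecidableEq κ]
    (Q : ℂ → ℝ) (N : ℕ) (e : ι ≃ κ) (ζ : κ → ℂ) :
    boltzmann Q N (ζ ∘ e) = boltzmann Q N ζ := by
  unfold boltzmann
  congr 1
  · refine Finset.prod_bij (fun q _ => (e q.1, e q.2)) (by simp) ?_ ?_ (by simp)
    · rintro ⟨a, b⟩ - ⟨c, d⟩ - h
      simpa using h
    · rintro ⟨a, b⟩ h
      exact ⟨(e.symm a, e.symm b), by simpa using h, by simp⟩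
  · exact Equiv.prod_comp e fun j => ‖ζ j - conj (ζ j)‖ ^ 2 * Real.exp (-(N * Q (ζ j)))

/-- The Vandermonde product of the points `ζ₁, conj ζ₁, ζ₂, conj ζ₂, …`. -/
theorem prod_vandermonde_conjPairs {n : ℕ} (ζ : Fin n → ℂ) (v : Fin (n * 2) → ℂ)
    (hv : ∀ a, v (finProdFinEquiv a) = conjPairs ζ a) :
    ∏ i, ∏ j ∈ Finset.Ioi i, (v j - v i) =
      (∏ j, (conj (ζ j) - ζ j)) * ∏ i, ∏ j ∈ Finset.Ioi i,
        ((‖ζ i - ζ j‖ : ℂ) ^ 2 * (‖ζ i - conj (ζ j)‖ : ℂ) ^ 2) := by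
  have hIoi : ∀ {m : ℕ} (i : Fin m) (f : Fin m → ℂ),
      ∏ j ∈ Finset.Ioi i, f j = ∏ j, if i < j then f j else 1 := by
    intro m i f
    rw [← Finset.prod_filter]
    congr 1
    ext; simp
  simp only [hIoi]
  rw [← Equiv.prod_comp finProdFinEquiv]
  simp_rw [← Equiv.prod_comp (finProdFinEquiv (m := n) (n := 2)) fun j => ite _ _ _]
  simp only [hv, Fintype.prod_prod_type, Fin.prod_univ_two, conjPairs_zero, conjPairs_one,
    Fin.lt_def, finProdFinEquiv_apply_val, Fin.val_zero, Fin.val_one]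
  rw [← Finset.prod_mul_distrib]
  refine Finset.prod_congr rfl fun i _ => ?_
  rw [← Finset.prod_mul_distrib]
  have hsq : ∀ z : ℂ, (‖z‖ : ℂ) ^ 2 = z * conj z := fun z => (Complex.mul_conj' z).symm
  have hterm : ∀ l : Fin n,
      ((if 0 + 2 * (i : ℕ) < 0 + 2 * (l : ℕ) then ζ l - ζ i else 1) *
        (if 0 + 2 * (i : ℕ) < 1 + 2 * (l : ℕ) then conj (ζ l) - ζ i else 1)) *
      ((if 1 + 2 * (i : ℕ) < 0 + 2 * (l : ℕ) then ζ l - conj (ζ i) else 1) *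
        (if 1 + 2 * (i : ℕ) < 1 + 2 * (l : ℕ) then conj (ζ l) - conj (ζ i) else 1)) =
      (if l = i then conj (ζ i) - ζ i else 1) *
        (if (i : ℕ) < l then (‖ζ i - ζ l‖ : ℂ) ^ 2 * (‖ζ i - conj (ζ l)‖ : ℂ) ^ 2 else 1) := by
    intro l
    rcases lt_trichotomy (i : ℕ) l with h | h | h
    · have hne : l ≠ i := fun h' => by rw [h'] at h; exact lt_irrefl _ h
      rw [if_pos (by omega), if_pos (by omega), if_pos (by omega), if_pos (by omega), if_neg hne,
        if_pos h, hsq, hsq]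
      simp only [map_sub, Complex.conj_conj]
      ring
    · have he : l = i := Fin.ext h.symm
      subst he
      simp
    · have hne : l ≠ i := fun h' => by rw [h'] at h; exact lt_irrefl _ h
      rw [if_neg (by omega), if_neg (by omega), if_neg (by omega), if_neg (by omega), if_neg hne,
        if_neg (by omega)]
      ring
  rw [Finset.prod_congr rfl fun l _ => hterm l, Finset.prod_mul_distrib,
    Finset.prod_ite_eq' Finset.univ i, if_pos (Finset.mem_univ i)]

theorem boltzmann_eq_vandermonde (Q : ℂ → ℝ) (N : ℕ) {n : ℕ} (ζ : Fin n → ℂ)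
    (v : Fin (n * 2) → ℂ) (hv : ∀ a, v (finProdFinEquiv a) = conjPairs ζ a) :
    (boltzmann Q N ζ : ℂ) = (∏ j, (ζ j - conj (ζ j)) * Real.exp (-(N * Q (ζ j)))) *
      ∏ i, ∏ j ∈ Finset.Ioi i, (v j - v i) := by
  rw [prod_vandermonde_conjPairs ζ v hv]
  have hoff : ∏ q ∈ (Finset.univ : Finset (Fin n)).offDiag,
      ((‖ζ q.1 - ζ q.2‖ : ℂ) * (‖ζ q.1 - conj (ζ q.2)‖ : ℂ)) =
      ∏ i, ∏ j ∈ Finset.Ioi i, ((‖ζ i - ζ j‖ : ℂ) ^ 2 * (‖ζ i - conj (ζ j)‖ : ℂ) ^ 2) := by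
    have h1 : ∏ q ∈ (Finset.univ : Finset (Fin n)).offDiag,
        ((‖ζ q.1 - ζ q.2‖ : ℂ) * (‖ζ q.1 - conj (ζ q.2)‖ : ℂ)) =
        ∏ i, ∏ j ∈ ({i}ᶜ : Finset (Fin n)), ((‖ζ j - ζ i‖ : ℂ) * (‖ζ j - conj (ζ i)‖ : ℂ)) := by
      rw [Finset.prod_sigma']
      refine Finset.prod_bij (fun q _ => ⟨q.2, q.1⟩) ?_ ?_ ?_ (by simp)
      · rintro ⟨a, b⟩ h
        simpa using h
      · rintro ⟨a, b⟩ - ⟨c, d⟩ - h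
        simp only [Sigma.mk.injEq, heq_eq_eq] at h
        simp [h.1, h.2]
      · rintro ⟨a, b⟩ h
        exact ⟨(b, a), by simpa using h, rfl⟩
    rw [h1, ← Finset.prod_prod_Ioi_mul_eq_prod_prod_off_diag
      fun j i => ((‖ζ j - ζ i‖ : ℂ) * (‖ζ j - conj (ζ i)‖ : ℂ))]
    refine Finset.prod_congr rfl fun i _ => Finset.prod_congr rfl fun j _ => ?_
    have h2 : ‖ζ j - conj (ζ i)‖ = ‖ζ i - conj (ζ j)‖ := by
      rw [← RCLike.norm_conj (ζ j - conj (ζ i)), map_sub, Complex.conj_conj, norm_sub_rev]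
    rw [h2, norm_sub_rev (ζ j)]
    ring
  unfold boltzmann
  push_cast
  rw [hoff, Finset.prod_mul_distrib, Finset.prod_mul_distrib]
  have hsq : ∏ j, (‖ζ j - conj (ζ j)‖ : ℂ) ^ 2 =
      (∏ j, (ζ j - conj (ζ j))) * ∏ j, (conj (ζ j) - ζ j) := by
    rw [← Finset.prod_mul_distrib]
    refine Finset.prod_congr rfl fun j _ => ?_
    rw [← Complex.mul_conj', map_sub, Complex.conj_conj]
  rw [hsq]
  ring

open Polynomial in
/-- In the Vandermonde determinant the monomials may be replaced by any monic polynomials. -/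
theorem boltzmann_eq_det {ι : Type*} [Fintype ι] [DecidableEq ι] (Q : ℂ → ℝ) (N : ℕ) {n : ℕ}
    (e : ι ≃ Fin n) (P : ℕ → Fin 2 → ℂ[X]) (hdeg : ∀ i s, (P i s).natDegree = 2 * i + s)
    (hmonic : ∀ i s, (P i s).Monic) (ζ : ι → ℂ) :
    (boltzmann Q N ζ : ℂ) = (∏ j, (ζ j - conj (ζ j)) * Real.exp (-(N * Q (ζ j)))) *
      (Matrix.of fun a b : ι × Fin 2 => (P (e a.1) a.2).eval (conjPairs ζ b)).det := by
  set ξ : Fin n → ℂ := ζ ∘ e.symm with hξ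
  have hb : boltzmann Q N ζ = boltzmann Q N ξ := (boltzmann_comp_equiv Q N e.symm ζ).symm
  set v : Fin (n * 2) → ℂ := fun x => conjPairs ξ (finProdFinEquiv.symm x) with hv
  rw [hb, boltzmann_eq_vandermonde Q N ξ v
      (fun a => congrArg (conjPairs ξ) (Equiv.symm_apply_apply _ a)), ← Matrix.det_vandermonde,
    Matrix.det_eval_matrixOfPolynomials_eq_det_vandermonde v
      (fun x => P (finProdFinEquiv.symm x).1 (finProdFinEquiv.symm x).2) ?_ (fun _ => hmonic _ _)]
  · congr 1
    · exact Equiv.prod_comp e.symm fun j => (ζ j - conj (ζ j)) * (Real.exp (-(N * Q (ζ j))) : ℂ)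
    · rw [← Matrix.det_transpose, ← Matrix.det_submatrix_equiv_self
        ((Equiv.prodCongr e (Equiv.refl (Fin 2))).trans finProdFinEquiv)]
      congr 1
      ext ⟨a, s⟩ ⟨b, t⟩
      simp only [hv, hξ, conjPairs, Matrix.of_apply, Matrix.transpose_apply, Matrix.submatrix_apply,
        Equiv.trans_apply, Equiv.symm_apply_apply, Equiv.prodCongr_apply, Prod.map_apply,
        Equiv.refl_apply, Function.comp_apply]
  · intro x
    obtain ⟨a, rfl⟩ := finProdFinEquiv.surjective x
    rw [hdeg, Equiv.symm_apply_apply, finProdFinEquiv_apply_val]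
    ring

end Vandermonde

/-! ### Gaussian moments and skew-orthogonal polynomials -/

section Moments

instance : SigmaFinite areaMeasure := by
  unfold areaMeasure; infer_instance

theorem integral_areaMeasure (f : ℂ → ℂ) :
    ∫ ζ, f ζ ∂areaMeasure = (Real.pi : ℂ)⁻¹ * ∫ ζ, f ζ := by
  rw [areaMeasure, integral_smul_nnreal_measure, NNReal.smul_def, Complex.real_smul]
  simp

theorem integral_areaMeasure_comp_isometry (L : ℂ ≃ₗᵢ[ℝ] ℂ) (f : ℂ → ℂ) :
    ∫ ζ, f (L ζ) ∂areaMeasure = ∫ ζ, f ζ ∂areaMeasure := by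
  rw [integral_areaMeasure, integral_areaMeasure]
  congr 1
  exact L.measurePreserving.integral_comp L.toHomeomorph.measurableEmbedding f

theorem integral_norm_pow_mul_gaussian {N : ℕ} (hN : 0 < N) (p : ℕ) :
    ∫ ζ : ℂ, ‖ζ‖ ^ (2 * p) * Real.exp (-(N * ‖ζ‖ ^ 2)) =
      Real.pi * (p.factorial / (N : ℝ) ^ (p + 1)) := by
  have h := Complex.integral_rpow_mul_exp_neg_mul_rpow (p := 2) (q := ((2 * p : ℕ) : ℝ))
    (b := N) (by norm_num) (lt_of_lt_of_le (by norm_num) (Nat.cast_nonneg _))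
    (by exact_mod_cast hN)
  simp only [Real.rpow_natCast, Real.rpow_two, neg_mul] at h
  rw [h]
  have h1 : (((2 * p : ℕ) : ℝ) + 2) / 2 = p + 1 := by push_cast; ring
  have h2 : -(((2 * p : ℕ) : ℝ) + 2) / 2 = -((p + 1 : ℕ) : ℝ) := by push_cast; ring
  rw [h1, h2, Real.Gamma_nat_eq_factorial, Real.rpow_neg (Nat.cast_nonneg _), Real.rpow_natCast]
  field_simp

theorem integrable_monomial_gaussian {N : ℕ} (hN : 0 < N) (p q : ℕ) :
    Integrable (fun ζ : ℂ => ζ ^ p * conj ζ ^ q * (Real.exp (-(N * ‖ζ‖ ^ 2)) : ℂ))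
      areaMeasure := by
  have hint : ∀ p : ℕ, Integrable fun ζ : ℂ => ‖ζ‖ ^ (2 * p) * Real.exp (-(N * ‖ζ‖ ^ 2)) := by
    intro p
    refine Integrable.of_integral_ne_zero ?_
    rw [integral_norm_pow_mul_gaussian hN]
    have := p.factorial_pos
    positivity
  refine Integrable.smul_measure_nnreal ?_
  refine ((hint p).add (hint q)).mono' (Continuous.aestronglyMeasurable (by fun_prop))
    (ae_of_all _ fun ζ => ?_)
  rw [norm_mul, norm_mul, norm_pow, norm_pow, RCLike.norm_conj, Complex.norm_real,
    Real.norm_of_nonneg (Real.exp_pos _).le, Pi.add_apply, ← add_mul]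
  gcongr
  rw [pow_mul', pow_mul']
  nlinarith [sq_nonneg (‖ζ‖ ^ p - ‖ζ‖ ^ q), sq_nonneg (‖ζ‖ ^ p + ‖ζ‖ ^ q)]

/-- Off-diagonal moments vanish by rotation invariance. -/
theorem integral_monomial_gaussian {N : ℕ} (hN : 0 < N) (p q : ℕ) :
    ∫ ζ : ℂ, ζ ^ p * conj ζ ^ q * (Real.exp (-(N * ‖ζ‖ ^ 2)) : ℂ) ∂areaMeasure =
      if p = q then (p.factorial : ℂ) / (N : ℂ) ^ (p + 1) else 0 := by
  split_ifs with hpq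
  · subst hpq
    have h1 : ∀ ζ : ℂ, ζ ^ p * conj ζ ^ p * (Real.exp (-(N * ‖ζ‖ ^ 2)) : ℂ) =
        ((‖ζ‖ ^ (2 * p) * Real.exp (-(N * ‖ζ‖ ^ 2)) : ℝ) : ℂ) := by
      intro ζ
      rw [← mul_pow, Complex.mul_conj']
      push_cast
      rw [pow_mul]
    simp only [h1]
    rw [integral_areaMeasure, integral_complex_ofReal, integral_norm_pow_mul_gaussian hN]
    push_cast
    rw [inv_mul_cancel_left₀ (Complex.ofReal_ne_zero.mpr Real.pi_ne_zero)]
  · -- The rotation by the angle `π / (p - q)` changes the sign of the integrand.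
    set t : ℝ := Real.pi / ((p : ℝ) - q) with ht
    have hsub : ((p : ℝ) - q) ≠ 0 := sub_ne_zero.mpr (by exact_mod_cast hpq)
    set c : Circle := Circle.exp t with hc
    have hrot := integral_areaMeasure_comp_isometry (rotation c)
      fun ζ => ζ ^ p * conj ζ ^ q * (Real.exp (-(N * ‖ζ‖ ^ 2)) : ℂ)
    have hcc : (c : ℂ) ^ p * conj (c : ℂ) ^ q = -1 := by
      rw [hc, Circle.coe_exp, ← Complex.exp_conj, ← Complex.exp_nat_mul, ← Complex.exp_nat_mul,
        ← Complex.exp_add, ← Complex.exp_pi_mul_I]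
      congr 1
      simp only [map_mul, Complex.conj_ofReal, Complex.conj_I]
      have : (p : ℂ) * (t * Complex.I) + q * (t * -Complex.I) =
          (((p : ℝ) - q) * t : ℝ) * Complex.I := by push_cast; ring
      rw [this, ht, mul_div_cancel₀ _ hsub]
    have hneg : ∀ ζ : ℂ, (rotation c ζ) ^ p * conj (rotation c ζ) ^ q *
        (Real.exp (-(N * ‖rotation c ζ‖ ^ 2)) : ℂ) =
        -(ζ ^ p * conj ζ ^ q * (Real.exp (-(N * ‖ζ‖ ^ 2)) : ℂ)) := by
      intro ζ
      rw [LinearIsometryEquiv.norm_map, rotation_apply, map_mul, mul_pow, mul_pow]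
      linear_combination (ζ ^ p * conj ζ ^ q * (Real.exp (-(N * ‖ζ‖ ^ 2)) : ℂ)) * hcc
    simp only [hneg, integral_neg] at hrot
    exact self_eq_neg.mp hrot.symm

end Moments

section SkewForm

open Polynomial

/-- The factor of the Boltzmann weight that belongs to a single particle. -/
noncomputable def skewWeight (N : ℕ) (ζ : ℂ) : ℂ :=
  (ζ - conj ζ) * (Real.exp (-(N * gaussianPotential ζ)) : ℂ)

/-- The skew-symmetric form `⟨P, Q⟩ = ∫ P(ζ) Q(conj ζ) (ζ - conj ζ) e^{-N |ζ|²} dA(ζ)`. -/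
noncomputable def skewForm (N : ℕ) (P Q : ℂ[X]) : ℂ :=
  ∫ ζ, P.eval ζ * Q.eval (conj ζ) * skewWeight N ζ ∂areaMeasure

variable {N : ℕ}

theorem monomial_mul_skewWeight (p q : ℕ) (ζ : ℂ) :
    ζ ^ p * conj ζ ^ q * skewWeight N ζ =
      ζ ^ (p + 1) * conj ζ ^ q * (Real.exp (-(N * ‖ζ‖ ^ 2)) : ℂ) -
        ζ ^ p * conj ζ ^ (q + 1) * (Real.exp (-(N * ‖ζ‖ ^ 2)) : ℂ) := by
  rw [skewWeight, gaussianPotential]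
  ring

theorem integrable_skewForm (hN : 0 < N) (P Q : ℂ[X]) :
    Integrable (fun ζ => P.eval ζ * Q.eval (conj ζ) * skewWeight N ζ) areaMeasure := by
  induction P using Polynomial.induction_on' with
  | add P₁ P₂ h₁ h₂ =>
    simp only [eval_add, add_mul]
    exact h₁.add h₂
  | monomial p a =>
    induction Q using Polynomial.induction_on' with
    | add Q₁ Q₂ h₁ h₂ =>
      simp only [eval_add, mul_add, add_mul]
      exact h₁.add h₂
    | monomial q b =>
      have h := ((integrable_monomial_gaussian hN (p + 1) q).sub
        (integrable_monomial_gaussian hN p (q + 1))).const_mul (a * b)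
      refine h.congr (ae_of_all _ fun ζ => ?_)
      simp only [Pi.sub_apply]
      rw [← monomial_mul_skewWeight, eval_monomial, eval_monomial]
      ring

theorem skewForm_add_left (hN : 0 < N) (P₁ P₂ Q : ℂ[X]) :
    skewForm N (P₁ + P₂) Q = skewForm N P₁ Q + skewForm N P₂ Q := by
  unfold skewForm
  rw [← integral_add (integrable_skewForm hN _ _) (integrable_skewForm hN _ _)]
  simp only [eval_add, add_mul]

theorem skewForm_C_mul_left (c : ℂ) (P Q : ℂ[X]) :
    skewForm N (C c * P) Q = c * skewForm N P Q := by
  unfold skewForm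
  rw [← integral_const_mul]
  simp only [eval_mul, eval_C, mul_assoc]

theorem skewForm_swap (P Q : ℂ[X]) : skewForm N Q P = -skewForm N P Q := by
  unfold skewForm
  rw [← integral_areaMeasure_comp_isometry Complex.conjLIE, ← integral_neg]
  congr 1
  funext ζ
  simp only [Complex.conjLIE_apply, Complex.conj_conj, skewWeight, gaussianPotential,
    RCLike.norm_conj]
  ring

theorem skewForm_X_pow (hN : 0 < N) (p q : ℕ) :
    skewForm N (X ^ p) (X ^ q) =
      (if p + 1 = q then ((p + 1).factorial : ℂ) / (N : ℂ) ^ (p + 2) else 0) -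
        (if p = q + 1 then (p.factorial : ℂ) / (N : ℂ) ^ (p + 1) else 0) := by
  unfold skewForm
  simp only [eval_pow, eval_X, monomial_mul_skewWeight]
  rw [integral_sub (integrable_monomial_gaussian hN _ _) (integrable_monomial_gaussian hN _ _),
    integral_monomial_gaussian hN, integral_monomial_gaussian hN]

/-- The monic skew-orthogonal polynomial of degree `2 i`, which is
`∑_{l ≤ i} (2 / N)^{i - l} (i! / l!) X^{2 l}`, by recursion on `i`. -/
noncomputable def evenSkewPoly (N : ℕ) : ℕ → ℂ[X]
  | 0 => 1
  | i + 1 => X ^ (2 * (i + 1)) + C (2 * (i + 1) / (N : ℂ)) * evenSkewPoly N i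

/-- The monic skew-orthogonal polynomials; that of index `(i, s)` has degree `2 i + s`. -/
noncomputable def skewPoly (N i : ℕ) (s : Fin 2) : ℂ[X] :=
  if s = 0 then evenSkewPoly N i else X ^ (2 * i + 1)

/-- The skew norm `⟨P_{2 i}, P_{2 i + 1}⟩`. -/
noncomputable def skewNorm (N i : ℕ) : ℂ := ((2 * i + 1).factorial : ℂ) / (N : ℂ) ^ (2 * i + 2)

theorem skewNorm_ne_zero (hN : 0 < N) (i : ℕ) : skewNorm N i ≠ 0 :=
  div_ne_zero (Nat.cast_ne_zero.mpr (Nat.factorial_ne_zero _))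
    (pow_ne_zero _ (Nat.cast_ne_zero.mpr hN.ne'))

theorem degree_C_mul_le_degree (c : ℂ) (P : ℂ[X]) : (C c * P).degree ≤ P.degree := by
  rw [← smul_eq_C_mul]
  exact degree_smul_le c P

theorem degree_evenSkewPoly_le (N i : ℕ) : (evenSkewPoly N i).degree ≤ (2 * i : ℕ) := by
  induction i with
  | zero => simp [evenSkewPoly]
  | succ i ih =>
    rw [evenSkewPoly]
    refine (degree_add_le _ _).trans (max_le (degree_X_pow_le _) ?_)
    refine (degree_C_mul_le_degree _ _).trans (ih.trans ?_)
    exact_mod_cast (by omega : 2 * i ≤ 2 * (i + 1))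

theorem degree_lower_lt (N i : ℕ) :
    (C (2 * (i + 1) / (N : ℂ)) * evenSkewPoly N i).degree < (2 * (i + 1) : ℕ) := by
  refine ((degree_C_mul_le_degree _ _).trans (degree_evenSkewPoly_le N i)).trans_lt ?_
  exact_mod_cast (by omega : 2 * i < 2 * (i + 1))

theorem monic_skewPoly (N i : ℕ) (s : Fin 2) : (skewPoly N i s).Monic := by
  unfold skewPoly
  split_ifs
  · cases i with
    | zero => exact monic_one
    | succ i => exact monic_X_pow_add (degree_lower_lt N i)
  · exact monic_X_pow _

theorem natDegree_skewPoly (N i : ℕ) (s : Fin 2) : (skewPoly N i s).natDegree = 2 * i + s := by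
  unfold skewPoly
  split_ifs with h
  · subst h
    cases i with
    | zero => simp [evenSkewPoly]
    | succ i =>
      rw [evenSkewPoly, natDegree_eq_of_degree_eq_some]
      rw [degree_add_eq_left_of_degree_lt] <;> rw [degree_X_pow]
      · rfl
      · exact degree_lower_lt N i
  · rw [natDegree_X_pow]
    fin_cases s <;> simp_all

theorem skewForm_evenSkewPoly_odd (hN : 0 < N) (i j : ℕ) :
    skewForm N (evenSkewPoly N i) (X ^ (2 * j + 1)) = if i = j then skewNorm N i else 0 := by
  have hN' : (N : ℂ) ≠ 0 := Nat.cast_ne_zero.mpr hN.ne'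
  induction i with
  | zero =>
    rw [evenSkewPoly, ← pow_zero X, skewForm_X_pow hN, skewNorm]
    rcases Nat.eq_zero_or_pos j with rfl | hj
    · simp
    · rw [if_neg (by omega), if_neg (by omega), if_neg (by omega), sub_zero]
  | succ i ih =>
    rw [evenSkewPoly, skewForm_add_left hN, skewForm_C_mul_left, ih, skewForm_X_pow hN]
    rcases eq_or_ne i j with rfl | h1
    · rw [if_neg (by omega), if_pos (by omega), if_pos rfl, if_neg (by omega), skewNorm,
        show 2 * (i + 1) = 2 * i + 1 + 1 by ring, Nat.factorial_succ (2 * i + 1)]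
      push_cast
      field_simp
      ring
    · rcases eq_or_ne (i + 1) j with rfl | h2
      · rw [if_pos (by omega), if_neg (by omega), if_neg (by omega), if_pos rfl, skewNorm]
        simp
      · rw [if_neg (by omega), if_neg (by omega), if_neg h1, if_neg h2]
        simp

theorem skewForm_evenSkewPoly_even (hN : 0 < N) (i j : ℕ) :
    skewForm N (evenSkewPoly N i) (evenSkewPoly N j) = 0 := by
  have h1 : ∀ i l, skewForm N (evenSkewPoly N i) (X ^ (2 * l)) = 0 := by
    intro i l
    induction i with
    | zero =>
      rw [evenSkewPoly, ← pow_zero X, skewForm_X_pow hN, if_neg (by omega), if_neg (by omega),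
        sub_zero]
    | succ i ih =>
      rw [evenSkewPoly, skewForm_add_left hN, skewForm_C_mul_left, ih, skewForm_X_pow hN,
        if_neg (by omega), if_neg (by omega)]
      simp
  rw [skewForm_swap, neg_eq_zero]
  induction j with
  | zero =>
    rw [skewForm_swap, evenSkewPoly, neg_eq_zero]
    exact h1 i 0
  | succ j ih =>
    rw [evenSkewPoly, skewForm_add_left hN, skewForm_C_mul_left, ih, skewForm_swap, h1]
    simp

theorem skewForm_odd_odd (hN : 0 < N) (i j : ℕ) :
    skewForm N (X ^ (2 * i + 1)) (X ^ (2 * j + 1)) = 0 := by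
  rw [skewForm_X_pow hN, if_neg (by omega), if_neg (by omega), sub_zero]

theorem skewForm_skewPoly (hN : 0 < N) {I : Type*} [Fintype I] [DecidableEq I] {n : ℕ}
    (e : I ≃ Fin n) (a b : I × Fin 2) :
    skewForm N (skewPoly N (e a.1) a.2) (skewPoly N (e b.1) b.2) =
      (∑ i, skewNorm N (e i) * ((if a = (i, 0) then 1 else 0) * (if b = (i, 1) then 1 else 0))) -
      ∑ i, skewNorm N (e i) *
        ((if b = (i, 0) then 1 else 0) * (if a = (i, 1) then 1 else 0)) := by
  obtain ⟨i, s⟩ := a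
  obtain ⟨j, t⟩ := b
  have hval : ((e i : ℕ) = e j) ↔ i = j := by rw [Fin.val_inj, e.apply_eq_iff_eq]
  have hval' : ((e j : ℕ) = e i) ↔ j = i := by rw [Fin.val_inj, e.apply_eq_iff_eq]
  have hsum : ∀ i j : I, ∑ x, skewNorm N (e x) * ((if i = x then 1 else 0) *
      (if j = x then 1 else 0)) = if i = j then skewNorm N (e i) else 0 := by
    intro i j
    rw [Finset.sum_eq_single i (by intro x _ hx; rw [if_neg hx.symm]; ring) (by simp)]
    simp [eq_comm]
  fin_cases s <;> fin_cases t
  · simp [skewPoly, skewForm_evenSkewPoly_even hN]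
  · simp only [skewPoly, Fin.zero_eta, Fin.mk_one, if_true, one_ne_zero, if_false,
      skewForm_evenSkewPoly_odd hN, hval, Prod.mk.injEq, and_true, zero_ne_one, and_false, hsum,
      mul_zero, Finset.sum_const_zero, sub_zero]
  · rw [skewForm_swap]
    simp only [skewPoly, Fin.zero_eta, Fin.mk_one, if_true, one_ne_zero, if_false,
      skewForm_evenSkewPoly_odd hN, hval', Prod.mk.injEq, and_true, zero_ne_one, and_false, hsum,
      mul_zero, Finset.sum_const_zero, zero_sub]
  · simp [skewPoly, skewForm_odd_odd hN]

end SkewForm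

/-! ### The correlation functions as Pfaffians -/

section Correlation

open Polynomial

variable {N : ℕ}

/-- Integrating the Boltzmann weight over the particles indexed by `β`. -/
theorem integral_boltzmann (hN : 0 < N) {α β : Type*} [Fintype α] [DecidableEq α] [Fintype β]
    [DecidableEq β] {n : ℕ} (e : α ⊕ β ≃ Fin n) (ζ : α → ℂ) :
    ((Fintype.card α).factorial : ℂ) * (∫ η : β → ℂ, boltzmann gaussianPotential N (Sum.elim ζ η)
      ∂(Measure.pi fun _ => areaMeasure) : ℝ) =
    (∏ j, skewWeight N (ζ j)) * (2 ^ Fintype.card β * ((Fintype.card β).factorial : ℂ) *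
      (∏ i : α ⊕ β, skewNorm N (e i)) * ∑ g : α → α ⊕ β, (∏ j, (skewNorm N (e (g j)))⁻¹) *
        (Matrix.of fun (a c : α × Fin 2) =>
          (skewPoly N (e (g c.1)) c.2).eval (conjPairs ζ a)).det) := by
  set p : (α ⊕ β) × Fin 2 → ℂ[X] := fun a => skewPoly N (e a.1) a.2 with hp
  have hdens : ∀ η : β → ℂ, (boltzmann gaussianPotential N (Sum.elim ζ η) : ℂ) =
      (∏ j, skewWeight N (ζ j)) * ∑ σ : Equiv.Perm ((α ⊕ β) × Fin 2),
        (((Equiv.Perm.sign σ : ℤ) : ℂ) *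
          (∏ j : α, (p (σ (Sum.inl j, 0))).eval (ζ j) * (p (σ (Sum.inl j, 1))).eval (conj (ζ j)))) *
          ∏ j : β, (p (σ (Sum.inr j, 0))).eval (η j) * (p (σ (Sum.inr j, 1))).eval (conj (η j)) *
            skewWeight N (η j) := by
    intro η
    rw [boltzmann_eq_det gaussianPotential N e (skewPoly N) (natDegree_skewPoly N)
      (monic_skewPoly N), det_pairs, Fintype.prod_sum_type, mul_assoc]
    congr 1
    rw [Finset.mul_sum]
    refine Finset.sum_congr rfl fun σ _ => ?_
    rw [Fintype.prod_sum_type]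
    simp only [Matrix.of_apply, conjPairs_zero, conjPairs_one, Sum.elim_inl, Sum.elim_inr,
      Finset.prod_mul_distrib, skewWeight, hp]
    ring
  have hint : ∀ σ : Equiv.Perm ((α ⊕ β) × Fin 2), Integrable (fun η : β → ℂ =>
      ∏ j : β, (p (σ (Sum.inr j, 0))).eval (η j) * (p (σ (Sum.inr j, 1))).eval (conj (η j)) *
            skewWeight N (η j)) (Measure.pi fun _ => areaMeasure) := fun σ =>
    Integrable.fintype_prod (f := fun j ζ => (p (σ (Sum.inr j, 0))).eval ζ *
      (p (σ (Sum.inr j, 1))).eval (conj ζ) * skewWeight N ζ)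
      fun j => integrable_skewForm hN _ _
  have hval : ((∫ η : β → ℂ, boltzmann gaussianPotential N (Sum.elim ζ η)
      ∂(Measure.pi fun _ => areaMeasure) : ℝ) : ℂ) =
      (∏ j, skewWeight N (ζ j)) * ∑ σ : Equiv.Perm ((α ⊕ β) × Fin 2),
        ((Equiv.Perm.sign σ : ℤ) : ℂ) *
          ((∏ j : α, (p (σ (Sum.inl j, 0))).eval (ζ j) *
            (p (σ (Sum.inl j, 1))).eval (conj (ζ j))) *
          ∏ j : β, skewForm N (p (σ (Sum.inr j, 0))) (p (σ (Sum.inr j, 1)))) := by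
    rw [← integral_complex_ofReal]
    simp only [hdens]
    rw [integral_const_mul, integral_finsetSum _ fun σ _ => (hint σ).const_mul _]
    congr 1
    refine Finset.sum_congr rfl fun σ _ => ?_
    rw [integral_const_mul, mul_assoc]
    congr 2
    exact integral_fintype_prod_eq_prod (fun (j : β) ζ => (p (σ (Sum.inr j, 0))).eval ζ *
      (p (σ (Sum.inr j, 1))).eval (conj ζ) * skewWeight N ζ)
  have hmain := sum_sign_partial_pairing (α := α) (β := β)
    (fun a b => (p a).eval (conjPairs ζ b)) (fun i => skewNorm N (e i))
    (fun i => skewNorm_ne_zero hN _) (fun a b => skewForm N (p a) (p b))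
    (fun a b => skewForm_skewPoly hN e a b)
  simp only [conjPairs_zero, conjPairs_one] at hmain
  rw [hval, mul_left_comm, hmain]

/-- The skew-symmetric kernel `∑_i (P_{2i}(x) P_{2i+1}(y) - P_{2i}(y) P_{2i+1}(x)) / r_i`; the
finite-size pre-kernel is `-1/2` times it. -/
noncomputable def wedgeKernel (N : ℕ) (x y : ℂ) : ℂ :=
  ∑ i : Fin N, (skewNorm N i)⁻¹ * ((skewPoly N i 0).eval x * (skewPoly N i 1).eval y -
    (skewPoly N i 0).eval y * (skewPoly N i 1).eval x)

theorem partitionFunction_eq (hN : 0 < N) :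
    (partitionFunction gaussianPotential N : ℂ) =
      2 ^ N * (N.factorial : ℂ) * ∏ i : Fin N, skewNorm N i := by
  have h := integral_boltzmann hN (Equiv.emptySum (Fin 0) (Fin N)) Fin.elim0
  have hb : ∀ η : Fin N → ℂ, boltzmann gaussianPotential N (Sum.elim Fin.elim0 η) =
      boltzmann gaussianPotential N η := fun η => by
    rw [← boltzmann_comp_equiv gaussianPotential N (Equiv.emptySum (Fin 0) (Fin N)) η]
    congr 1
    funext x
    rcases x with x | x
    · exact x.elim0
    · rfl
  simp only [hb] at h
  rw [partitionFunction]
  simpa [Fintype.prod_sum_type] using h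

theorem correlation_eq_pfaffian (hN : 0 < N) {k : ℕ} (hk : k ≤ N) (ζ : Fin k → ℂ) :
    (correlation gaussianPotential N k ζ : ℂ) = (∏ j, skewWeight N (ζ j)) * ((1 / 2) ^ k *
      pfaffian (Matrix.of fun a b => wedgeKernel N (conjPairs ζ a) (conjPairs ζ b))) := by
  obtain ⟨m, rfl⟩ := Nat.exists_eq_add_of_le hk
  set n := k + m with hn
  have hm : n - k = m := by omega
  set e : Fin k ⊕ Fin m ≃ Fin n := finSumFinEquiv
  have h := integral_boltzmann hN e ζ
  have hp := pfaffian_sum_wedge (k := k) (fun i : Fin k ⊕ Fin m => (skewNorm n (e i))⁻¹)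
    (fun a b => (skewPoly n (e a.1) a.2).eval (conjPairs ζ b))
  have hw : ∀ x y, wedgeKernel n x y = ∑ i : Fin k ⊕ Fin m, (skewNorm n (e i))⁻¹ *
      ((skewPoly n (e i) 0).eval x * (skewPoly n (e i) 1).eval y -
        (skewPoly n (e i) 0).eval y * (skewPoly n (e i) 1).eval x) := fun x y =>
    (Equiv.sum_comp e fun i : Fin n => (skewNorm n i)⁻¹ *
      ((skewPoly n i 0).eval x * (skewPoly n i 1).eval y -
        (skewPoly n i 0).eval y * (skewPoly n i 1).eval x)).symm
  simp only [← hw] at hp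
  rw [hp]
  have hprod : ∏ i : Fin k ⊕ Fin m, skewNorm n (e i) = ∏ i : Fin n, skewNorm n i :=
    Equiv.prod_comp e fun i : Fin n => skewNorm n i
  rw [hprod, Fintype.card_fin, Fintype.card_fin] at h
  have hr : ∏ i : Fin n, skewNorm n i ≠ 0 :=
    Finset.prod_ne_zero_iff.mpr fun i _ => skewNorm_ne_zero hN _
  unfold correlation
  push_cast
  rw [partitionFunction_eq hN]
  have hint : ∀ m', m' = m → ((∫ η : Fin m' → ℂ, boltzmann gaussianPotential n (Sum.elim ζ η)
      ∂(Measure.pi fun _ => areaMeasure) : ℝ) : ℂ) = ((∫ η : Fin m → ℂ,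
        boltzmann gaussianPotential n (Sum.elim ζ η)
          ∂(Measure.pi fun _ => areaMeasure) : ℝ) : ℂ) := by
    rintro _ rfl; rfl
  rw [hint _ hm]
  have hkf : (k.factorial : ℂ) ≠ 0 := Nat.cast_ne_zero.mpr k.factorial_ne_zero
  have hnf : (n.factorial : ℂ) ≠ 0 := Nat.cast_ne_zero.mpr n.factorial_ne_zero
  have hfac : (n.factorial : ℂ) = m.factorial * n.descFactorial k := by
    rw [← Nat.factorial_mul_descFactorial hk, hm]; push_cast; ring
  rw [← mul_right_inj' hkf, mul_left_comm, h]
  have h2n : (2 : ℂ) ^ n = 2 ^ k * 2 ^ m := pow_add _ _ _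
  rw [h2n]
  have h2 : (2 : ℂ) ^ k ≠ 0 := pow_ne_zero _ two_ne_zero
  have h2' : (2 : ℂ) ^ m ≠ 0 := pow_ne_zero _ two_ne_zero
  rw [one_div, inv_pow]
  field_simp
  rw [hfac]
  ring

end Correlation

/-! ### The complementary error function -/

section Erfc

theorem hasDerivAt_erfc (z : ℂ) :
    HasDerivAt erfc (-(2 / (Real.sqrt Real.pi : ℂ)) * Complex.exp (-z ^ 2)) z := by
  have hd : Differentiable ℂ fun z : ℂ => Complex.exp (-z ^ 2) := by fun_prop
  obtain ⟨g, hg⟩ := hd.isExactOn_univ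
  have hg' : ∀ z, HasDerivAt g (Complex.exp (-z ^ 2)) z := fun z => hg z (Set.mem_univ z)
  have herfc : erfc = fun z => 1 - 2 / (Real.sqrt Real.pi : ℂ) * (g z - g 0) := by
    funext w
    have hpath : ∀ t ∈ Set.uIcc (0 : ℝ) 1,
        HasDerivAt (fun t : ℝ => g ((t : ℂ) * w)) (w * Complex.exp (-((t : ℂ) * w) ^ 2)) t := by
      intro t _
      have h1 : HasDerivAt (fun t : ℂ => t * w) w (t : ℂ) := by
        simpa using (hasDerivAt_id (t : ℂ)).mul_const w
      have h2 := (hg' ((t : ℂ) * w)).comp (t : ℂ) h1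
      rw [mul_comm]
      exact h2.comp_ofReal
    have hint := intervalIntegral.integral_eq_sub_of_hasDerivAt hpath
      (Continuous.intervalIntegrable (by fun_prop) _ _)
    simp only [Complex.ofReal_one, one_mul, Complex.ofReal_zero, zero_mul] at hint
    rw [erfc, hint]
  rw [herfc]
  have h := (((hg' z).sub_const (g 0)).const_mul (2 / (Real.sqrt Real.pi : ℂ))).const_sub 1
  simpa only [neg_mul] using h

theorem tendsto_erfc_ofReal : Tendsto (fun x : ℝ => erfc (x : ℂ)) atTop (𝓝 0) := by
  have hint : IntegrableOn (fun x : ℝ => Real.exp (-1 * x ^ 2)) (Set.Ioi 0) :=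
    (integrable_exp_neg_mul_sq one_pos).integrableOn
  have h := intervalIntegral_tendsto_integral_Ioi 0 hint tendsto_id
  rw [integral_gaussian_Ioi, div_one] at h
  have heq : ∀ x : ℝ, erfc (x : ℂ) =
      ((1 - 2 / Real.sqrt Real.pi * ∫ t in (0 : ℝ)..x, Real.exp (-1 * t ^ 2) : ℝ) : ℂ) := by
    intro x
    have hfun : ∀ t : ℝ, (x : ℂ) * Complex.exp (-((t : ℂ) * x) ^ 2) =
        ((x * Real.exp (-1 * (t * x) ^ 2) : ℝ) : ℂ) := by
      intro t; push_cast; ring_nf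
    rw [erfc]
    simp only [hfun]
    rw [intervalIntegral.integral_ofReal, intervalIntegral.integral_const_mul,
      intervalIntegral.mul_integral_comp_mul_right (f := fun t => Real.exp (-1 * t ^ 2))]
    push_cast
    simp
  simp only [heq]
  have h2 := ((h.const_mul (2 / Real.sqrt Real.pi)).const_sub 1)
  have hz : 1 - 2 / Real.sqrt Real.pi * (Real.sqrt Real.pi / 2) = 0 := by
    have : Real.sqrt Real.pi ≠ 0 := (Real.sqrt_pos.mpr Real.pi_pos).ne'
    field_simp
    ring
  rw [hz] at h2
  exact_mod_cast (Complex.continuous_ofReal.tendsto 0).comp h2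

/-- The complementary error function decays along horizontal lines. -/
theorem tendsto_erfc_add_ofReal (w : ℂ) : Tendsto (fun x : ℝ => erfc (w + x)) atTop (𝓝 0) := by
  have hbound : ∀ x : ℝ, ‖erfc (w + x) - erfc ((w.re + x : ℝ) : ℂ)‖ ≤
      2 / Real.sqrt Real.pi * Real.exp (w.im ^ 2) * |w.im| * Real.exp (-(w.re + x) ^ 2) := by
    intro x
    set S : Set ℂ := {v | v.re = w.re + x ∧ |v.im| ≤ |w.im|} with hS
    have hconv : Convex ℝ S := by
      intro a ha b hb s t hs ht hst
      refine ⟨?_, ?_⟩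
      · simp only [Complex.add_re, Complex.real_smul, Complex.re_ofReal_mul, ha.1, hb.1]
        rw [← add_mul, hst, one_mul]
      · simp only [Complex.add_im, Complex.real_smul, Complex.im_ofReal_mul]
        calc |s * a.im + t * b.im| ≤ |s * a.im| + |t * b.im| := abs_add_le _ _
          _ = s * |a.im| + t * |b.im| := by
              rw [abs_mul, abs_mul, abs_of_nonneg hs, abs_of_nonneg ht]
          _ ≤ s * |w.im| + t * |w.im| := add_le_add (mul_le_mul_of_nonneg_left ha.2 hs)
              (mul_le_mul_of_nonneg_left hb.2 ht)
          _ = |w.im| := by rw [← add_mul, hst, one_mul]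
    have h := hconv.norm_image_sub_le_of_norm_hasDerivWithin_le
      (f := erfc) (x := ((w.re + x : ℝ) : ℂ)) (y := w + x)
      (C := 2 / Real.sqrt Real.pi * (Real.exp (w.im ^ 2) * Real.exp (-(w.re + x) ^ 2)))
      (fun v _ => (hasDerivAt_erfc v).hasDerivWithinAt) (fun v hv => ?_) ?_ ?_
    · have hn : ‖w + x - ((w.re + x : ℝ) : ℂ)‖ = |w.im| := by
        have : w + x - ((w.re + x : ℝ) : ℂ) = (w.im : ℂ) * Complex.I := by
          apply Complex.ext <;> simp
        rw [this, norm_mul, Complex.norm_I, mul_one, Complex.norm_real, Real.norm_eq_abs]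
      rw [hn] at h
      calc _ ≤ _ := h
        _ = _ := by ring
    · rw [norm_mul, norm_neg, norm_div, Complex.norm_real, Complex.norm_exp,
        Real.norm_of_nonneg (Real.sqrt_nonneg _), Complex.norm_ofNat, ← Real.exp_add]
      have hre : (-v ^ 2).re = v.im ^ 2 - v.re ^ 2 := by
        simp [pow_two]
      rw [hre, hv.1]
      have := sq_le_sq.mpr hv.2
      gcongr
      linarith
    · simp [hS]
    · simp [hS]
  have hexp : Tendsto (fun x : ℝ => Real.exp (-(w.re + x) ^ 2)) atTop (𝓝 0) := by
    refine Real.tendsto_exp_atBot.comp ?_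
    have : Tendsto (fun x : ℝ => (w.re + x) ^ 2) atTop atTop :=
      (tendsto_pow_atTop two_ne_zero).comp (tendsto_atTop_add_const_left _ _ tendsto_id)
    exact tendsto_neg_atTop_atBot.comp this
  have hdiff : Tendsto (fun x : ℝ => erfc (w + x) - erfc ((w.re + x : ℝ) : ℂ)) atTop (𝓝 0) := by
    refine squeeze_zero_norm hbound ?_
    simpa using hexp.const_mul (2 / Real.sqrt Real.pi * Real.exp (w.im ^ 2) * |w.im|)
  have hreal := tendsto_erfc_ofReal.comp
    (tendsto_atTop_add_const_left atTop w.re (tendsto_id (α := ℝ)))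
  simpa using hdiff.add hreal

/-- The Gaussian tail `erfc(√2 z) / 2`, the common profile of the functions `f_z`. -/
noncomputable def edgeTail (z : ℂ) : ℂ := (1 / 2) * erfc ((Real.sqrt 2 : ℂ) * z)

/-- The Gaussian density `√(2 / π) e^{-2 z²}`, which is minus the derivative of `edgeTail`. -/
noncomputable def edgeDensity (z : ℂ) : ℂ :=
  (Real.sqrt 2 : ℂ) / (Real.sqrt Real.pi : ℂ) * Complex.exp (-2 * z ^ 2)

theorem ofReal_sqrt_sq {x : ℝ} (hx : 0 ≤ x) : (Real.sqrt x : ℂ) ^ 2 = x := by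
  rw [← Complex.ofReal_pow, Real.sq_sqrt hx]

theorem hasDerivAt_edgeTail (z : ℂ) : HasDerivAt edgeTail (-edgeDensity z) z := by
  have h1 : HasDerivAt (fun z : ℂ => (Real.sqrt 2 : ℂ) * z) (Real.sqrt 2 : ℂ) z := by
    simpa using (hasDerivAt_id z).const_mul (Real.sqrt 2 : ℂ)
  have h2 := ((hasDerivAt_erfc _).comp z h1).const_mul (1 / 2 : ℂ)
  refine h2.congr_deriv ?_
  have h3 : -((Real.sqrt 2 : ℂ) * z) ^ 2 = -2 * z ^ 2 := by
    rw [mul_pow, ofReal_sqrt_sq zero_le_two]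
    push_cast
    ring
  rw [h3, edgeDensity]
  ring

theorem continuous_edgeTail : Continuous edgeTail :=
  continuous_iff_continuousAt.mpr fun z => (hasDerivAt_edgeTail z).continuousAt

theorem continuous_edgeDensity : Continuous edgeDensity := by
  unfold edgeDensity; fun_prop

theorem hasDerivAt_add_ofReal {f : ℂ → ℂ} {f' : ℂ} {z : ℂ} {s : ℝ}
    (h : HasDerivAt f f' (z + s)) : HasDerivAt (fun s : ℝ => f (z + s)) f' s := by
  have h1 : HasDerivAt (fun s : ℂ => z + s) 1 (s : ℂ) := (hasDerivAt_id _).const_add z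
  have h2 := (HasDerivAt.comp (s : ℂ) h h1).comp_ofReal
  simpa using h2

theorem tendsto_edgeTail_add_ofReal (z : ℂ) :
    Tendsto (fun s : ℝ => edgeTail (z + s)) atTop (𝓝 0) := by
  have h := (tendsto_erfc_add_ofReal ((Real.sqrt 2 : ℂ) * z)).comp
    (tendsto_id.const_mul_atTop (Real.sqrt_pos.mpr zero_lt_two))
  have h2 := h.const_mul (1 / 2 : ℂ)
  rw [mul_zero] at h2
  refine h2.congr fun s => ?_
  simp [edgeTail, mul_add]

theorem integrable_edgeDensity_add_ofReal (z : ℂ) :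
    Integrable fun s : ℝ => edgeDensity (z + s) := by
  have h := (integrable_cexp_quadratic' (b := -2) (by norm_num) (-4 * z) (-2 * z ^ 2)).const_mul
    ((Real.sqrt 2 : ℂ) / (Real.sqrt Real.pi : ℂ))
  refine h.congr (ae_of_all _ fun s => ?_)
  simp only [edgeDensity]
  ring_nf

theorem edgeTail_eq_integral (z : ℂ) :
    edgeTail z = ∫ s in Set.Ioi (0 : ℝ), edgeDensity (z + s) := by
  have h := integral_Ioi_of_hasDerivAt_of_tendsto' (a := 0)
    (fun s _ => hasDerivAt_add_ofReal (hasDerivAt_edgeTail (z + (s : ℝ))))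
    (integrable_edgeDensity_add_ofReal z).neg.integrableOn (tendsto_edgeTail_add_ofReal z)
  rw [integral_neg] at h
  simpa using h.symm

theorem edgeFun_eq (z : ℂ) : edgeFun z = fun u : ℝ => edgeTail (z - u) := rfl

theorem hasDerivAt_edgeFun (z : ℂ) (u : ℝ) : HasDerivAt (edgeFun z) (edgeDensity (z - u)) u := by
  have h1 : HasDerivAt (fun s : ℂ => z - s) (-1) (u : ℂ) := (hasDerivAt_id _).const_sub z
  have h2 := ((hasDerivAt_edgeTail _).comp (u : ℂ) h1).comp_ofReal
  rw [edgeFun_eq]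
  simpa using h2

theorem wronskian_edgeFun (z w : ℂ) (u : ℝ) :
    wronskian (edgeFun w) (edgeFun z) u =
      edgeTail (w - u) * edgeDensity (z - u) - edgeTail (z - u) * edgeDensity (w - u) := by
  rw [wronskian, (hasDerivAt_edgeFun z u).deriv, (hasDerivAt_edgeFun w u).deriv, edgeFun_eq,
    edgeFun_eq]
  ring

theorem integrableOn_edgeTail_mul_edgeDensity (z w : ℂ) :
    IntegrableOn (fun s : ℝ => edgeTail (w + s) * edgeDensity (z + s)) (Set.Ici 0) := by
  have hc1 := continuous_edgeTail
  have hc2 := continuous_edgeDensity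
  refine LocallyIntegrableOn.integrableOn_of_isBigO_atTop
    (g := fun s : ℝ => edgeDensity (z + s)) ?_ ?_ ?_
  · exact (Continuous.locallyIntegrable (by fun_prop)).locallyIntegrableOn _
  · have h := (tendsto_edgeTail_add_ofReal w).isBigO_one ℂ
    simpa using h.mul (Asymptotics.isBigO_refl (fun s : ℝ => edgeDensity (z + s)) atTop)
  · exact (integrable_edgeDensity_add_ofReal z).integrableAtFilter _

theorem wronskian_edgeFun_neg (z w : ℂ) (s : ℝ) :
    wronskian (edgeFun w) (edgeFun z) (-s) =
      edgeTail (w + s) * edgeDensity (z + s) - edgeTail (z + s) * edgeDensity (w + s) := by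
  rw [wronskian_edgeFun, Complex.ofReal_neg, sub_neg_eq_add, sub_neg_eq_add]

theorem integrableOn_wronskian (z w : ℂ) :
    IntegrableOn (wronskian (edgeFun w) (edgeFun z)) (Set.Iio (0 : ℝ)) := by
  have h := (integrableOn_edgeTail_mul_edgeDensity z w).sub
    (integrableOn_edgeTail_mul_edgeDensity w z)
  rw [← neg_zero (G := ℝ)] at h
  have h2 := h.comp_neg_Iic
  refine (h2.mono_set Set.Iio_subset_Iic_self).congr (ae_of_all _ fun u => ?_)
  have := wronskian_edgeFun_neg z w (-u)
  rw [neg_neg] at this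
  rw [this]
  simp

theorem integral_wronskian (z w : ℂ) :
    ∫ u in Set.Iio (0 : ℝ), wronskian (edgeFun w) (edgeFun z) u =
      ∫ s in Set.Ioi (0 : ℝ),
        (edgeTail (w + s) * edgeDensity (z + s) - edgeTail (z + s) * edgeDensity (w + s)) := by
  have h := integral_comp_neg_Ioi 0 (wronskian (edgeFun w) (edgeFun z))
  rw [neg_zero, integral_Iic_eq_integral_Iio] at h
  rw [← h]
  simp only [wronskian_edgeFun_neg]

end Erfc

/-! ### Truncated exponentials at the edge -/

section TruncatedExponential

/-- The truncated exponential series `∑_{j < n} x^j / j!`. -/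
noncomputable def expSum (n : ℕ) (x : ℂ) : ℂ := ∑ j ∈ Finset.range n, x ^ j / (j.factorial : ℂ)

/-- `a^{2 N} e^{-a²}` at the edge point `a = √N + z`, divided by its maximum `N^N e^{-N}` over real
`a`. -/
noncomputable def edgePower (N : ℕ) (z : ℂ) : ℂ :=
  (((Real.sqrt N : ℂ) + z) ^ 2 / N) ^ N * Complex.exp (N - ((Real.sqrt N : ℂ) + z) ^ 2)

/-- `e^{-a²} ∑_{j < N} a^{2 j} / j!` at the edge point `a = √N + z`. -/
noncomputable def edgeExpSum (N : ℕ) (z : ℂ) : ℂ :=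
  Complex.exp (-((Real.sqrt N : ℂ) + z) ^ 2) * expSum N (((Real.sqrt N : ℂ) + z) ^ 2)

/-- The Stirling ratio `N^N e^{-N} √N / N!`. -/
noncomputable def stirlingRatio (N : ℕ) : ℝ :=
  (N : ℝ) ^ N * Real.exp (-N) * Real.sqrt N / N.factorial

/-- Minus the derivative of `edgeExpSum N`. -/
noncomputable def edgeExpSumDensity (N : ℕ) (z : ℂ) : ℂ :=
  2 * (stirlingRatio N : ℂ) * (edgePower N z * ((Real.sqrt N : ℂ) / ((Real.sqrt N : ℂ) + z)))

theorem expSum_succ (n : ℕ) (x : ℂ) :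
    expSum (n + 1) x = expSum n x + x ^ n / (n.factorial : ℂ) := Finset.sum_range_succ _ _

theorem hasDerivAt_exp_neg_mul_expSum (n : ℕ) (x : ℂ) :
    HasDerivAt (fun x => Complex.exp (-x) * expSum (n + 1) x)
      (-(Complex.exp (-x) * (x ^ n / (n.factorial : ℂ)))) x := by
  have hexp : HasDerivAt (fun x : ℂ => Complex.exp (-x)) (-Complex.exp (-x)) x := by
    simpa using (hasDerivAt_neg x).cexp
  induction n with
  | zero => simpa [expSum] using hexp
  | succ n ih =>
    have h1 : HasDerivAt (fun x : ℂ => x ^ (n + 1) / ((n + 1).factorial : ℂ))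
        (x ^ n / (n.factorial : ℂ)) x := by
      refine ((hasDerivAt_pow (n + 1) x).div_const _).congr_deriv ?_
      have : (n.factorial : ℂ) ≠ 0 := Nat.cast_ne_zero.mpr n.factorial_ne_zero
      have : (n : ℂ) + 1 ≠ 0 := Nat.cast_add_one_ne_zero n
      rw [Nat.factorial_succ, Nat.add_sub_cancel]
      push_cast
      field_simp
    simp only [expSum_succ (n + 1), mul_add]
    refine (ih.add (hexp.mul h1)).congr_deriv ?_
    ring

theorem hasDerivAt_exp_neg_sq_mul_expSum (n : ℕ) (a : ℂ) :
    HasDerivAt (fun a => Complex.exp (-a ^ 2) * expSum (n + 1) (a ^ 2))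
      (-(2 * a * (Complex.exp (-a ^ 2) * (a ^ (2 * n) / (n.factorial : ℂ))))) a := by
  have h1 : HasDerivAt (fun a : ℂ => a ^ 2) (2 * a) a := by
    simpa using hasDerivAt_pow 2 a
  refine ((hasDerivAt_exp_neg_mul_expSum n (a ^ 2)).comp a h1).congr_deriv ?_
  rw [← pow_mul]
  ring

theorem edgePower_eq (N : ℕ) (z : ℂ) :
    edgePower N z * ((N : ℂ) ^ N * Complex.exp (-N)) =
      ((Real.sqrt N : ℂ) + z) ^ (2 * N) * Complex.exp (-((Real.sqrt N : ℂ) + z) ^ 2) := by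
  have h : Complex.exp (N - ((Real.sqrt N : ℂ) + z) ^ 2) * Complex.exp (-N) =
      Complex.exp (-((Real.sqrt N : ℂ) + z) ^ 2) := by
    rw [← Complex.exp_add]; ring_nf
  rw [edgePower, pow_mul, ← h]
  rcases Nat.eq_zero_or_pos N with rfl | hN
  · simp
  · have : (N : ℂ) ≠ 0 := Nat.cast_ne_zero.mpr hN.ne'
    rw [div_pow]
    field_simp

theorem hasDerivAt_edgeExpSum {N : ℕ} (hN : 0 < N) {z : ℂ} (hz : (Real.sqrt N : ℂ) + z ≠ 0) :
    HasDerivAt (edgeExpSum N) (-edgeExpSumDensity N z) z := by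
  obtain ⟨n, rfl⟩ := Nat.exists_eq_succ_of_ne_zero hN.ne'
  have h1 : HasDerivAt (fun z : ℂ => (Real.sqrt (n.succ : ℕ) : ℂ) + z) 1 z :=
    (hasDerivAt_id z).const_add _
  refine ((hasDerivAt_exp_neg_sq_mul_expSum n _).comp z h1).congr_deriv ?_
  have hpow := edgePower_eq n.succ z
  set a : ℂ := (Real.sqrt (n.succ : ℕ) : ℂ) + z with ha
  have hs : (Real.sqrt (n.succ : ℕ) : ℂ) * (Real.sqrt (n.succ : ℕ) : ℂ) = (n.succ : ℕ) := by
    rw [← pow_two, ofReal_sqrt_sq (Nat.cast_nonneg _)]; simp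
  have hfac : ((n.succ).factorial : ℂ) = (n.succ : ℕ) * n.factorial := by
    rw [Nat.factorial_succ]; push_cast; ring
  have hne : ((n.succ : ℕ) : ℂ) ≠ 0 := Nat.cast_ne_zero.mpr hN.ne'
  have hnf : (n.factorial : ℂ) ≠ 0 := Nat.cast_ne_zero.mpr n.factorial_ne_zero
  have hdens : edgeExpSumDensity n.succ z =
      2 * (edgePower n.succ z * (((n.succ : ℕ) : ℂ) ^ n.succ * Complex.exp (-(n.succ : ℕ)))) *
        ((Real.sqrt (n.succ : ℕ) : ℂ) * (Real.sqrt (n.succ : ℕ) : ℂ)) /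
          ((n.succ).factorial * a) := by
    rw [edgeExpSumDensity, stirlingRatio, ← ha]
    push_cast
    field_simp
  rw [hdens, hpow, hs, hfac, show 2 * n.succ = 2 * n + 1 + 1 by simp [Nat.succ_eq_add_one]; ring,
    pow_succ, pow_succ]
  field_simp
  ring

/-- A Gaussian bound, weakened to an exponential one, that is uniform in `N`. -/
theorem norm_edgePower_le {N : ℕ} (hN : 0 < N) (z : ℂ) :
    ‖edgePower N z‖ ≤ Real.exp (2 * z.im ^ 2 + 1 - z.re) := by
  have hN' : (0 : ℝ) < N := Nat.cast_pos.mpr hN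
  set q := Real.sqrt N with hq
  have hq0 : 0 < q := Real.sqrt_pos.mpr hN'
  have hqq : q ^ 2 = N := Real.sq_sqrt hN'.le
  set a : ℂ := (q : ℂ) + z with ha
  set ρ := ‖a‖ with hρ
  have hre : ((N : ℂ) - a ^ 2).re = N - ρ ^ 2 + 2 * z.im ^ 2 := by
    rw [hρ, ← Complex.normSq_eq_norm_sq, Complex.normSq_apply]
    have h1 : a.im = z.im := by simp [ha]
    rw [Complex.sub_re, pow_two, Complex.mul_re, Complex.natCast_re, ← h1]
    ring
  -- The inequality `x ≤ e^{x - 1}` at `x = ρ / √N`.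
  have hx : (ρ / q) ^ (2 * N) ≤ Real.exp (2 * N * (ρ / q - 1)) := by
    have h1 : ρ / q ≤ Real.exp (ρ / q - 1) := by
      have := Real.add_one_le_exp (ρ / q - 1)
      linarith
    calc (ρ / q) ^ (2 * N) ≤ Real.exp (ρ / q - 1) ^ (2 * N) := by gcongr
      _ = _ := by rw [← Real.exp_nat_mul]; push_cast; ring_nf
  have hρre : q + z.re ≤ ρ := by
    have := Complex.re_le_norm a
    simpa [ha] using this
  have hnorm : ‖edgePower N z‖ = (ρ / q) ^ (2 * N) * Real.exp (N - ρ ^ 2 + 2 * z.im ^ 2) := by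
    have hd : ρ ^ 2 / (N : ℝ) = (ρ / q) ^ 2 := by rw [div_pow, hqq]
    rw [edgePower, norm_mul, Complex.norm_exp, hre, norm_pow, norm_div, norm_pow,
      Complex.norm_natCast, ← hρ, hd, ← pow_mul]
  rw [hnorm]
  calc _ ≤ Real.exp (2 * N * (ρ / q - 1)) * Real.exp (N - ρ ^ 2 + 2 * z.im ^ 2) := by gcongr
    _ = Real.exp (2 * z.im ^ 2 - (ρ - q) ^ 2) := by
        rw [← Real.exp_add]
        congr 1
        rw [← hqq]
        field_simp
        ring
    _ ≤ _ := by
        apply Real.exp_le_exp.mpr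
        nlinarith [sq_nonneg (ρ - q - 1)]

theorem norm_edgeExpSumDensity_le {N : ℕ} (hN : 0 < N) (hb : stirlingRatio N ≤ 1) {z : ℂ}
    (hz : -(Real.sqrt N / 2) ≤ z.re) :
    ‖edgeExpSumDensity N z‖ ≤ 4 * Real.exp (2 * z.im ^ 2 + 1 - z.re) := by
  have hN' : (0 : ℝ) < N := Nat.cast_pos.mpr hN
  set q := Real.sqrt N with hq
  have hq0 : 0 < q := Real.sqrt_pos.mpr hN'
  have hb0 : 0 ≤ stirlingRatio N := by unfold stirlingRatio; positivity
  have hlow : q / 2 ≤ ‖(q : ℂ) + z‖ := by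
    have := Complex.re_le_norm ((q : ℂ) + z)
    simp only [Complex.add_re, Complex.ofReal_re] at this
    linarith
  have hfrac : ‖(q : ℂ) / ((q : ℂ) + z)‖ ≤ 2 := by
    rw [norm_div, Complex.norm_real, Real.norm_of_nonneg hq0.le, div_le_iff₀ (by linarith)]
    linarith
  have hP := norm_edgePower_le hN z
  rw [edgeExpSumDensity, norm_mul, norm_mul, norm_mul, Complex.norm_real,
    Real.norm_of_nonneg hb0, Complex.norm_ofNat]
  calc 2 * stirlingRatio N * (‖edgePower N z‖ * ‖(q : ℂ) / ((q : ℂ) + z)‖)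
      ≤ 2 * 1 * (Real.exp (2 * z.im ^ 2 + 1 - z.re) * 2) := by gcongr
    _ = _ := by ring

theorem tendsto_add_ofReal_pow_mul_exp (c : ℂ) (j : ℕ) :
    Tendsto (fun s : ℝ => (c + s) ^ j * Complex.exp (-(c + s) ^ 2)) atTop (𝓝 0) := by
  have hnorm : Tendsto (fun s : ℝ => ‖c + s‖) atTop atTop := by
    refine tendsto_atTop_mono (fun s => ?_)
      (tendsto_atTop_add_const_left atTop c.re (tendsto_id (α := ℝ)))
    simpa using Complex.re_le_norm (c + s)
  have h1 := (Real.tendsto_pow_mul_exp_neg_atTop_nhds_zero j).comp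
    ((tendsto_pow_atTop two_ne_zero).comp hnorm)
  have h2 := h1.mul_const (Real.exp (2 * c.im ^ 2))
  rw [zero_mul] at h2
  refine squeeze_zero_norm' ?_ h2
  filter_upwards [hnorm.eventually_ge_atTop 1] with s hs
  rw [norm_mul, norm_pow, Complex.norm_exp]
  have hre : (-(c + s) ^ 2).re = -‖c + s‖ ^ 2 + 2 * c.im ^ 2 := by
    rw [← Complex.normSq_eq_norm_sq, Complex.normSq_apply]
    simp [pow_two]
    ring
  rw [hre, Real.exp_add, ← mul_assoc]
  simp only [Function.comp_apply]
  gcongr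
  exact le_self_pow₀ hs two_ne_zero

theorem tendsto_exp_mul_expSum_add_ofReal (c : ℂ) (n : ℕ) :
    Tendsto (fun s : ℝ => Complex.exp (-(c + s) ^ 2) * expSum n ((c + s) ^ 2)) atTop (𝓝 0) := by
  have h := tendsto_finsetSum (Finset.range n) fun j _ =>
    (tendsto_add_ofReal_pow_mul_exp c (2 * j)).div_const (j.factorial : ℂ)
  simp only [zero_div, Finset.sum_const_zero] at h
  refine h.congr fun s => ?_
  rw [expSum, Finset.mul_sum]
  refine Finset.sum_congr rfl fun j _ => ?_
  rw [pow_mul]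
  ring

theorem tendsto_edgeExpSum_add_ofReal (N : ℕ) (z : ℂ) :
    Tendsto (fun s : ℝ => edgeExpSum N (z + s)) atTop (𝓝 0) := by
  have h := tendsto_exp_mul_expSum_add_ofReal ((Real.sqrt N : ℂ) + z) N
  simpa only [edgeExpSum, add_assoc] using h

theorem continuous_edgePower (N : ℕ) : Continuous (edgePower N) := by
  unfold edgePower; fun_prop

theorem continuous_edgeExpSum (N : ℕ) : Continuous (edgeExpSum N) := by
  unfold edgeExpSum expSum; fun_prop

/-- The bound that dominates `edgePower N (z + s)` for `z` near `z₀` and `s ≥ 0`. -/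
noncomputable def edgeBound (z₀ : ℂ) : ℝ := Real.exp (2 * (|z₀.im| + 1) ^ 2 + 1 - (z₀.re - 1))

theorem exp_le_edgeBound {z z₀ : ℂ} (h1 : z₀.re - 1 ≤ z.re) (h2 : |z.im| ≤ |z₀.im| + 1) (s : ℝ) :
    Real.exp (2 * (z + s).im ^ 2 + 1 - (z + s).re) ≤ edgeBound z₀ * Real.exp (-s) := by
  rw [edgeBound, ← Real.exp_add]
  apply Real.exp_le_exp.mpr
  have h3 : z.im ^ 2 ≤ (|z₀.im| + 1) ^ 2 := by
    rw [← sq_abs z.im]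
    gcongr
  simp only [Complex.add_im, Complex.ofReal_im, add_zero, Complex.add_re, Complex.ofReal_re]
  linarith

/-- The standing assumptions on `N` and `z` for the domination by `edgeBound z₀`. -/
def EdgeRegime (z₀ : ℂ) (N : ℕ) (z : ℂ) : Prop :=
  0 < N ∧ stirlingRatio N ≤ 1 ∧ -(Real.sqrt N / 2) ≤ z.re ∧ z₀.re - 1 ≤ z.re ∧
    |z.im| ≤ |z₀.im| + 1

theorem EdgeRegime.add_ne_zero {z₀ z : ℂ} {N : ℕ} (h : EdgeRegime z₀ N z) {s : ℝ} (hs : 0 ≤ s) :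
    (Real.sqrt N : ℂ) + (z + s) ≠ 0 := by
  obtain ⟨hN, -, hz, -, -⟩ := h
  have hq0 : 0 < Real.sqrt N := Real.sqrt_pos.mpr (Nat.cast_pos.mpr hN)
  intro h0
  have := congrArg Complex.re h0
  simp only [Complex.add_re, Complex.ofReal_re, Complex.zero_re] at this
  linarith

theorem EdgeRegime.norm_edgePower_le {z₀ z : ℂ} {N : ℕ} (h : EdgeRegime z₀ N z) (s : ℝ) :
    ‖edgePower N (z + s)‖ ≤ edgeBound z₀ * Real.exp (-s) :=
  (SymplecticGinibre.norm_edgePower_le h.1 _).trans (exp_le_edgeBound h.2.2.2.1 h.2.2.2.2 s)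

theorem EdgeRegime.norm_density_le {z₀ z : ℂ} {N : ℕ} (h : EdgeRegime z₀ N z) {s : ℝ}
    (hs : 0 ≤ s) : ‖edgeExpSumDensity N (z + s)‖ ≤ 4 * edgeBound z₀ * Real.exp (-s) := by
  have hz : -(Real.sqrt N / 2) ≤ (z + s).re := by
    simp only [Complex.add_re, Complex.ofReal_re]
    linarith [h.2.2.1]
  calc _ ≤ _ := norm_edgeExpSumDensity_le h.1 h.2.1 hz
    _ ≤ 4 * (edgeBound z₀ * Real.exp (-s)) := by
        gcongr
        exact exp_le_edgeBound h.2.2.2.1 h.2.2.2.2 s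
    _ = _ := by ring

theorem EdgeRegime.aestronglyMeasurable_density {z₀ z : ℂ} {N : ℕ} (h : EdgeRegime z₀ N z) :
    AEStronglyMeasurable (fun s : ℝ => edgeExpSumDensity N (z + s))
      (volume.restrict (Set.Ioi 0)) := by
  refine ContinuousOn.aestronglyMeasurable ?_ measurableSet_Ioi
  have hP := continuous_edgePower N
  unfold edgeExpSumDensity
  refine ContinuousOn.mul continuousOn_const (ContinuousOn.mul (by fun_prop) ?_)
  exact ContinuousOn.div continuousOn_const (by fun_prop)
    fun s hs => h.add_ne_zero (Set.mem_Ioi.mp hs).le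

theorem EdgeRegime.edgeExpSum_eq {z₀ z : ℂ} {N : ℕ} (h : EdgeRegime z₀ N z) {t : ℝ}
    (ht : 0 ≤ t) :
    edgeExpSum N (z + t) = ∫ s in Set.Ioi t, edgeExpSumDensity N (z + s) := by
  have hint : IntegrableOn (fun s : ℝ => edgeExpSumDensity N (z + s)) (Set.Ioi t) := by
    refine Integrable.mono' ((integrableOn_exp_neg_Ioi t).const_mul (4 * edgeBound z₀))
      (h.aestronglyMeasurable_density.mono_set (Set.Ioi_subset_Ioi ht)) ?_
    refine (ae_restrict_iff' measurableSet_Ioi).mpr (ae_of_all _ fun s hs => ?_)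
    exact h.norm_density_le (ht.trans (Set.mem_Ioi.mp hs).le)
  have h1 := integral_Ioi_of_hasDerivAt_of_tendsto' (a := t)
    (fun s hs => hasDerivAt_add_ofReal
      (hasDerivAt_edgeExpSum h.1 (h.add_ne_zero (ht.trans (Set.mem_Ici.mp hs)))))
    hint.neg (tendsto_edgeExpSum_add_ofReal N z)
  rw [integral_neg] at h1
  simpa using h1.symm

theorem EdgeRegime.norm_edgeExpSum_le {z₀ z : ℂ} {N : ℕ} (h : EdgeRegime z₀ N z) {t : ℝ}
    (ht : 0 ≤ t) : ‖edgeExpSum N (z + t)‖ ≤ 4 * edgeBound z₀ * Real.exp (-t) := by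
  rw [h.edgeExpSum_eq ht, ← integral_exp_neg_Ioi, ← integral_const_mul]
  refine norm_integral_le_of_norm_le ((integrableOn_exp_neg_Ioi t).const_mul _) ?_
  refine (ae_restrict_iff' measurableSet_Ioi).mpr (ae_of_all _ fun s hs => ?_)
  exact h.norm_density_le (ht.trans (Set.mem_Ioi.mp hs).le)

end TruncatedExponential

section Limits

theorem stirlingRatio_eq {N : ℕ} :
    stirlingRatio N = (Real.sqrt 2 * Stirling.stirlingSeq N)⁻¹ := by
  rcases Nat.eq_zero_or_pos N with rfl | hN
  · simp [stirlingRatio, Stirling.stirlingSeq]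
  have hN' : (0 : ℝ) < N := Nat.cast_pos.mpr hN
  have hf : (0 : ℝ) < N.factorial := Nat.cast_pos.mpr N.factorial_pos
  have h2 : Real.sqrt 2 ≠ 0 := (Real.sqrt_pos.mpr zero_lt_two).ne'
  have hq : Real.sqrt N ≠ 0 := (Real.sqrt_pos.mpr hN').ne'
  rw [stirlingRatio, Stirling.stirlingSeq, Real.sqrt_mul zero_le_two, div_pow, ← Real.exp_nat_mul,
    mul_one, Real.exp_neg]
  have he : Real.exp N ≠ 0 := (Real.exp_pos _).ne'
  field_simp

theorem tendsto_stirlingRatio :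
    Tendsto stirlingRatio atTop (𝓝 (Real.sqrt 2 * Real.sqrt Real.pi)⁻¹) := by
  have h := (Stirling.tendsto_stirlingSeq_sqrt_pi.const_mul (Real.sqrt 2)).inv₀ (by positivity)
  exact h.congr fun N => stirlingRatio_eq.symm

theorem eventually_stirlingRatio_le_one : ∀ᶠ N in atTop, stirlingRatio N ≤ 1 := by
  refine (tendsto_stirlingRatio.eventually_lt_const ?_).mono fun N h => h.le
  rw [← Real.sqrt_mul zero_le_two]
  apply inv_lt_one_of_one_lt₀
  rw [Real.lt_sqrt zero_le_one]
  nlinarith [Real.pi_gt_three]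

/-- The ratio `4^N N! N^N e^{-N} / (2 N)!`. -/
noncomputable def centralRatio (N : ℕ) : ℝ :=
  4 ^ N * N.factorial / (2 * N).factorial * ((N : ℝ) ^ N * Real.exp (-N))

theorem tendsto_centralRatio : Tendsto centralRatio atTop (𝓝 (Real.sqrt 2)⁻¹) := by
  have h1 := Stirling.tendsto_stirlingSeq_sqrt_pi
  have h2 := h1.comp (tendsto_id.const_mul_atTop' (zero_lt_two (α := ℕ)))
  have hpi : Real.sqrt Real.pi ≠ 0 := (Real.sqrt_pos.mpr Real.pi_pos).ne'
  have h3 := (h1.div h2 hpi).const_mul (Real.sqrt 2)⁻¹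
  rw [div_self hpi, mul_one] at h3
  refine h3.congr' ?_
  filter_upwards [eventually_gt_atTop 0] with N hN
  have hN' : (0 : ℝ) < N := Nat.cast_pos.mpr hN
  have hf : ((2 * N).factorial : ℝ) ≠ 0 := Nat.cast_ne_zero.mpr (Nat.factorial_ne_zero _)
  have hq : Real.sqrt N ≠ 0 := (Real.sqrt_pos.mpr hN').ne'
  have h2 : Real.sqrt 2 ≠ 0 := (Real.sqrt_pos.mpr zero_lt_two).ne'
  have he : Real.exp N ≠ 0 := (Real.exp_pos _).ne'
  have hpow : Real.exp ((2 * N : ℕ) : ℝ) = Real.exp N * Real.exp N := by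
    rw [← Real.exp_add]; push_cast; ring_nf
  have hsq : Real.sqrt (2 * ((2 * N : ℕ) : ℝ)) = 2 * Real.sqrt N := by
    have : (2 : ℝ) * ((2 * N : ℕ) : ℝ) = 2 ^ 2 * N := by push_cast; ring
    rw [this, Real.sqrt_mul (by norm_num), Real.sqrt_sq zero_le_two]
  simp only [Pi.div_apply, Function.comp_apply, id_eq, Stirling.stirlingSeq, centralRatio]
  rw [hsq, Real.sqrt_mul zero_le_two, div_pow, div_pow, ← Real.exp_nat_mul, ← Real.exp_nat_mul,
    mul_one, mul_one, hpow, Real.exp_neg]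
  have h4 : ((2 * N : ℕ) : ℝ) ^ (2 * N) = 4 ^ N * ((N : ℝ) ^ N * (N : ℝ) ^ N) := by
    push_cast
    rw [mul_pow, pow_mul, ← pow_add, two_mul N]
    norm_num
  have h5 : Real.sqrt 2 * Real.sqrt 2 = 2 := Real.mul_self_sqrt zero_le_two
  rw [h4]
  field_simp
  rw [pow_two, h5]

variable {ι : Type*} {l : Filter ι} {n : ι → ℕ} {z : ι → ℂ} {z₀ : ℂ}

theorem tendsto_sqrt_natCast (hn : Tendsto n l atTop) :
    Tendsto (fun i => Real.sqrt (n i)) l atTop :=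
  Real.tendsto_sqrt_atTop.comp (tendsto_natCast_atTop_atTop.comp hn)

theorem eventually_edgeRegime (hn : Tendsto n l atTop) (hz : Tendsto z l (𝓝 z₀)) :
    ∀ᶠ i in l, EdgeRegime z₀ (n i) (z i) := by
  have hre := (Complex.continuous_re.tendsto z₀).comp hz
  have him := ((continuous_abs.comp Complex.continuous_im).tendsto z₀).comp hz
  filter_upwards [hn.eventually_gt_atTop 0, hn.eventually eventually_stirlingRatio_le_one,
    (tendsto_sqrt_natCast hn).eventually_ge_atTop (2 * (1 - z₀.re)),
    hre.eventually_const_le (sub_one_lt z₀.re), him.eventually_le_const (lt_add_one |z₀.im|)]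
    with i h1 h2 h3 h4 h5
  simp only [Function.comp_apply] at h4 h5
  exact ⟨h1, h2, by linarith, h4, h5⟩

theorem tendsto_edgePower (hn : Tendsto n l atTop) (hz : Tendsto z l (𝓝 z₀)) :
    Tendsto (fun i => edgePower (n i) (z i)) l (𝓝 (Complex.exp (-2 * z₀ ^ 2))) := by
  have hs := tendsto_sqrt_natCast hn
  have hsinv : Tendsto (fun i => ((Real.sqrt (n i) : ℂ))⁻¹) l (𝓝 0) := by
    have := (Complex.continuous_ofReal.tendsto 0).comp hs.inv_tendsto_atTop
    simpa [Function.comp_def] using this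
  set y : ι → ℂ := fun i => z i * ((Real.sqrt (n i) : ℂ))⁻¹ with hy
  have hy0 : Tendsto y l (𝓝 0) := by simpa using hz.mul hsinv
  set err : ι → ℂ := fun i =>
    2 * (n i : ℂ) * (Complex.log (1 + y i) - (y i - (y i) ^ 2 / 2)) with herr
  have hynorm : ∀ᶠ i in l, ‖y i‖ < 1 / 2 := by
    have := hy0.norm
    rw [norm_zero] at this
    exact this.eventually_lt_const (by norm_num)
  have hny : ∀ᶠ i in l, (Real.sqrt (n i) : ℂ) * y i = z i := by
    filter_upwards [hs.eventually_gt_atTop 0] with i hi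
    have : (Real.sqrt (n i) : ℂ) ≠ 0 := Complex.ofReal_ne_zero.mpr hi.ne'
    simp only [hy]
    field_simp
  clear_value y
  have herr0 : Tendsto err l (𝓝 0) := by
    have hb : Tendsto (fun i => 2 * (‖z i‖ ^ 2 * ‖y i‖)) l (𝓝 0) := by
      have := (((hz.norm.pow 2).mul hy0.norm).const_mul 2)
      simpa using this
    refine squeeze_zero_norm' ?_ hb
    filter_upwards [hynorm, hny] with i hi hi2
    have hlog := Complex.norm_log_sub_logTaylor_le 2 (z := y i) (by linarith)
    have hT : Complex.logTaylor (2 + 1) (y i) = y i - (y i) ^ 2 / 2 := by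
      simp [Complex.logTaylor, Finset.sum_range_succ]
      ring
    rw [hT] at hlog
    have hinv : (1 - ‖y i‖)⁻¹ ≤ 2 := by
      rw [inv_le_comm₀ (by linarith) two_pos]
      linarith
    have hNn : (n i : ℝ) * ‖y i‖ ^ 2 = ‖z i‖ ^ 2 := by
      rw [← hi2, norm_mul, Complex.norm_real, Real.norm_of_nonneg (Real.sqrt_nonneg _), mul_pow,
        Real.sq_sqrt (Nat.cast_nonneg _)]
    simp only [herr]
    rw [norm_mul, norm_mul, Complex.norm_ofNat, Complex.norm_natCast]
    calc 2 * (n i : ℝ) * ‖Complex.log (1 + y i) - (y i - (y i) ^ 2 / 2)‖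
        ≤ 2 * (n i : ℝ) * (‖y i‖ ^ (2 + 1) * (1 - ‖y i‖)⁻¹ / ((2 : ℕ) + 1)) := by gcongr
      _ ≤ 2 * (n i : ℝ) * (‖y i‖ ^ (2 + 1) * 2 / ((2 : ℕ) + 1)) := by gcongr
      _ = 4 / 3 * (((n i : ℝ) * ‖y i‖ ^ 2) * ‖y i‖) := by push_cast; ring
      _ ≤ 2 * (‖z i‖ ^ 2 * ‖y i‖) := by
        rw [hNn]
        have : 0 ≤ ‖z i‖ ^ 2 * ‖y i‖ := by positivity
        linarith
  have hlim : Tendsto (fun i => Complex.exp (err i - 2 * (z i) ^ 2)) l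
      (𝓝 (Complex.exp (-2 * z₀ ^ 2))) := by
    have := (herr0.sub ((hz.pow 2).const_mul 2))
    rw [zero_sub, ← neg_mul] at this
    exact (Complex.continuous_exp.tendsto _).comp this
  refine hlim.congr' ?_
  filter_upwards [hynorm, hny, hs.eventually_gt_atTop 0] with i hi hi2 hi3
  have hne : 1 + y i ≠ 0 := by
    intro h0
    have : y i = -1 := by linear_combination h0
    rw [this] at hi
    norm_num at hi
  set q : ℂ := (Real.sqrt (n i) : ℂ) with hq
  have hqq : q ^ 2 = n i := by
    rw [hq, ofReal_sqrt_sq (Nat.cast_nonneg _)]; simp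
  have hq0 : q ≠ 0 := Complex.ofReal_ne_zero.mpr hi3.ne'
  have hbase : (q + z i) ^ 2 / (n i : ℂ) = (1 + y i) ^ 2 := by
    rw [← hi2, ← hqq]
    field_simp
  rw [edgePower, ← hq, hbase, ← Complex.exp_log hne, ← Complex.exp_nat_mul, ← Complex.exp_nat_mul,
    ← Complex.exp_add]
  congr 1
  simp only [herr, ← hi2]
  rw [← hqq]
  push_cast
  ring

theorem tendsto_edgeExpSumDensity (hn : Tendsto n l atTop) (hz : Tendsto z l (𝓝 z₀)) :
    Tendsto (fun i => edgeExpSumDensity (n i) (z i)) l (𝓝 (edgeDensity z₀)) := by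
  have hs := tendsto_sqrt_natCast hn
  have hsinv : Tendsto (fun i => ((Real.sqrt (n i) : ℂ))⁻¹) l (𝓝 0) := by
    have := (Complex.continuous_ofReal.tendsto 0).comp hs.inv_tendsto_atTop
    simpa [Function.comp_def] using this
  have hfrac : Tendsto (fun i => (Real.sqrt (n i) : ℂ) / ((Real.sqrt (n i) : ℂ) + z i)) l
      (𝓝 1) := by
    have h1 : Tendsto (fun i => (1 + z i * ((Real.sqrt (n i) : ℂ))⁻¹)⁻¹) l (𝓝 1) := by
      have := ((hz.mul hsinv).const_add 1).inv₀ (by simp)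
      simpa using this
    refine h1.congr' ?_
    filter_upwards [hs.eventually_gt_atTop 0] with i hi
    have : (Real.sqrt (n i) : ℂ) ≠ 0 := Complex.ofReal_ne_zero.mpr hi.ne'
    have h2 : 1 + z i * ((Real.sqrt (n i) : ℂ))⁻¹ =
        ((Real.sqrt (n i) : ℂ) + z i) / (Real.sqrt (n i) : ℂ) := by field_simp
    rw [h2, inv_div]
  have hst := (Complex.continuous_ofReal.tendsto _).comp (tendsto_stirlingRatio.comp hn)
  have h := (hst.const_mul 2).mul ((tendsto_edgePower hn hz).mul hfrac)
  have hval : 2 * (((Real.sqrt 2 * Real.sqrt Real.pi)⁻¹ : ℝ) : ℂ) *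
      (Complex.exp (-2 * z₀ ^ 2) * 1) = edgeDensity z₀ := by
    have h2 : (Real.sqrt 2 : ℂ) ≠ 0 :=
      Complex.ofReal_ne_zero.mpr (Real.sqrt_pos.mpr zero_lt_two).ne'
    have hpi : (Real.sqrt Real.pi : ℂ) ≠ 0 :=
      Complex.ofReal_ne_zero.mpr (Real.sqrt_pos.mpr Real.pi_pos).ne'
    have h22 : (Real.sqrt 2 : ℂ) ^ 2 = 2 := by rw [ofReal_sqrt_sq zero_le_two]; simp
    rw [edgeDensity]
    push_cast
    field_simp
    rw [h22]
  rw [hval] at h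
  exact h

theorem tendsto_edgeExpSum [l.IsCountablyGenerated] (hn : Tendsto n l atTop)
    (hz : Tendsto z l (𝓝 z₀)) :
    Tendsto (fun i => edgeExpSum (n i) (z i)) l (𝓝 (edgeTail z₀)) := by
  have hreg := eventually_edgeRegime hn hz
  have h := tendsto_integral_filter_of_dominated_convergence
    (μ := volume.restrict (Set.Ioi (0 : ℝ))) (l := l)
    (F := fun i (s : ℝ) => edgeExpSumDensity (n i) (z i + s))
    (f := fun s => edgeDensity (z₀ + s)) (fun s => 4 * edgeBound z₀ * Real.exp (-s))
    (hreg.mono fun i hi => hi.aestronglyMeasurable_density)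
    (hreg.mono fun i hi => (ae_restrict_iff' measurableSet_Ioi).mpr
      (ae_of_all _ fun s hs => hi.norm_density_le (Set.mem_Ioi.mp hs).le))
    ((integrableOn_exp_neg_Ioi 0).const_mul _)
    (ae_of_all _ fun s => tendsto_edgeExpSumDensity hn (hz.add_const _))
  rw [← edgeTail_eq_integral] at h
  refine h.congr' ?_
  filter_upwards [hreg] with i hi
  have := hi.edgeExpSum_eq le_rfl
  simpa using this.symm

end Limits

/-! ### Edge limit of the pre-kernel -/

section PreKernel

/-- The skew-symmetric sum
`∑_{i < N} 4^i i! / (2 i + 1)! (a^{2 i + 1} e_{i + 1}(b²) - b^{2 i + 1} e_{i + 1}(a²))`, in which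
`e_n` is the truncated exponential. -/
noncomputable def skewSum (N : ℕ) (a b : ℂ) : ℂ :=
  ∑ i ∈ Finset.range N, (4 ^ i * (i.factorial : ℂ) / ((2 * i + 1).factorial : ℂ)) *
    (a ^ (2 * i + 1) * expSum (i + 1) (b ^ 2) - b ^ (2 * i + 1) * expSum (i + 1) (a ^ 2))

theorem hasDerivAt_add_left {f : ℂ → ℂ} {f' c s : ℂ} (h : HasDerivAt f f' (c + s)) :
    HasDerivAt (fun s => f (c + s)) f' s := by
  have h1 : HasDerivAt (fun s : ℂ => c + s) 1 s := (hasDerivAt_id s).const_add c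
  exact (HasDerivAt.comp s h h1).congr_deriv (mul_one _)

theorem hasDerivAt_pow_mul_exp_neg_sq (m : ℕ) (a : ℂ) :
    HasDerivAt (fun a : ℂ => a ^ (m + 1) * Complex.exp (-a ^ 2))
      (((m + 1) * a ^ m - 2 * a ^ (m + 2)) * Complex.exp (-a ^ 2)) a := by
  have h2 : HasDerivAt (fun a : ℂ => a ^ 2) (2 * a) a := by simpa using hasDerivAt_pow 2 a
  refine ((hasDerivAt_pow (m + 1) a).mul h2.neg.cexp).congr_deriv ?_
  rw [Nat.add_sub_cancel, Pi.neg_apply]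
  push_cast
  ring

/-- The derivative in the direction `(1, 1)` of the weighted pre-kernel telescopes to a single
Wronskian-type expression. -/
theorem hasDerivAt_skewSum (N : ℕ) (a b s : ℂ) :
    HasDerivAt (fun s : ℂ => Complex.exp (-(a + s) ^ 2 - (b + s) ^ 2) * skewSum N (a + s) (b + s))
      ((4 ^ N * (N.factorial : ℂ) / ((2 * N).factorial : ℂ)) *
        (Complex.exp (-(a + s) ^ 2 - (b + s) ^ 2) * ((b + s) ^ (2 * N) * expSum N ((a + s) ^ 2) -
          (a + s) ^ (2 * N) * expSum N ((b + s) ^ 2)))) s := by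
  induction N with
  | zero =>
    simp only [skewSum, Finset.range_zero, Finset.sum_empty, mul_zero, expSum, sub_zero]
    exact hasDerivAt_const s 0
  | succ N ih =>
    have hu : ∀ c : ℂ, HasDerivAt
        (fun s => (c + s) ^ (2 * N + 1) * Complex.exp (-(c + s) ^ 2))
        ((((2 * N : ℕ) + 1) * (c + s) ^ (2 * N) - 2 * (c + s) ^ (2 * N + 2)) *
          Complex.exp (-(c + s) ^ 2)) s := fun c =>
      hasDerivAt_add_left (hasDerivAt_pow_mul_exp_neg_sq (2 * N) (c + s))
    have hv : ∀ c : ℂ, HasDerivAt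
        (fun s => Complex.exp (-(c + s) ^ 2) * expSum (N + 1) ((c + s) ^ 2))
        (-(2 * (c + s) * (Complex.exp (-(c + s) ^ 2) *
          ((c + s) ^ (2 * N) / (N.factorial : ℂ))))) s := fun c =>
      hasDerivAt_add_left (f := fun c => Complex.exp (-c ^ 2) * expSum (N + 1) (c ^ 2))
        (hasDerivAt_exp_neg_sq_mul_expSum N (c + s))
    have hterm := (((hu a).mul (hv b)).sub ((hu b).mul (hv a))).const_mul
      (4 ^ N * (N.factorial : ℂ) / ((2 * N + 1).factorial : ℂ))
    have hexp : ∀ s : ℂ, Complex.exp (-(a + s) ^ 2 - (b + s) ^ 2) =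
        Complex.exp (-(a + s) ^ 2) * Complex.exp (-(b + s) ^ 2) := fun s => by
      rw [← Complex.exp_add, sub_eq_add_neg]
    have hfun : (fun s : ℂ => Complex.exp (-(a + s) ^ 2 - (b + s) ^ 2) *
        skewSum (N + 1) (a + s) (b + s)) = fun s =>
        Complex.exp (-(a + s) ^ 2 - (b + s) ^ 2) * skewSum N (a + s) (b + s) +
        (4 ^ N * (N.factorial : ℂ) / ((2 * N + 1).factorial : ℂ)) *
        ((a + s) ^ (2 * N + 1) * Complex.exp (-(a + s) ^ 2) *
          (Complex.exp (-(b + s) ^ 2) * expSum (N + 1) ((b + s) ^ 2)) -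
        (b + s) ^ (2 * N + 1) * Complex.exp (-(b + s) ^ 2) *
          (Complex.exp (-(a + s) ^ 2) * expSum (N + 1) ((a + s) ^ 2))) := by
      funext s
      rw [skewSum, Finset.sum_range_succ, ← skewSum, hexp]
      ring
    rw [hfun]
    refine (ih.add hterm).congr_deriv ?_
    have hN1 : (N.factorial : ℂ) ≠ 0 := Nat.cast_ne_zero.mpr N.factorial_ne_zero
    have hN2 : ((2 * N).factorial : ℂ) ≠ 0 := Nat.cast_ne_zero.mpr (Nat.factorial_ne_zero _)
    have h2N : (2 * (N : ℂ) + 1) ≠ 0 := by exact_mod_cast Nat.succ_ne_zero (2 * N)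
    have hNN : ((N : ℂ) + 1) ≠ 0 := Nat.cast_add_one_ne_zero N
    have hf1 : ((2 * N + 1).factorial : ℂ) = (2 * N + 1) * ((2 * N).factorial : ℂ) := by
      rw [Nat.factorial_succ]; push_cast; ring
    have hf2 : ((2 * (N + 1)).factorial : ℂ) =
        2 * (N + 1) * ((2 * N + 1) * ((2 * N).factorial : ℂ)) := by
      rw [← hf1, show 2 * (N + 1) = 2 * N + 1 + 1 by ring, Nat.factorial_succ]; push_cast; ring
    have hf3 : ((N + 1).factorial : ℂ) = (N + 1) * (N.factorial : ℂ) := by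
      rw [Nat.factorial_succ]; push_cast; ring
    rw [hf1, hf2, hf3, expSum_succ, expSum_succ, hexp, ← pow_mul, ← pow_mul]
    push_cast
    generalize Complex.exp (-(a + s) ^ 2) = ea
    generalize Complex.exp (-(b + s) ^ 2) = eb
    generalize expSum N ((a + s) ^ 2) = xa
    generalize expSum N ((b + s) ^ 2) = xb
    generalize a + s = u
    generalize b + s = v
    rw [show 2 * (N + 1) = 2 * N + 2 by ring]
    field_simp
    ring

/-- The pre-kernel at the edge points `√N + z` and `√N + w`, with an analytic weight. -/
noncomputable def scaledPreKernel (N : ℕ) (z w : ℂ) : ℂ :=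
  2 * (Complex.exp (-((Real.sqrt N : ℂ) + z) ^ 2 - ((Real.sqrt N : ℂ) + w) ^ 2) *
    skewSum N ((Real.sqrt N : ℂ) + z) ((Real.sqrt N : ℂ) + w))

theorem hasDerivAt_scaledPreKernel (N : ℕ) (z w : ℂ) (s : ℝ) :
    HasDerivAt (fun s : ℝ => scaledPreKernel N (z + s) (w + s))
      (2 * (centralRatio N : ℂ) * (edgePower N (w + s) * edgeExpSum N (z + s) -
        edgePower N (z + s) * edgeExpSum N (w + s))) s := by
  have h := ((hasDerivAt_skewSum N ((Real.sqrt N : ℂ) + z) ((Real.sqrt N : ℂ) + w)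
    (s : ℂ)).const_mul 2).comp_ofReal
  simp only [add_assoc] at h
  refine h.congr_deriv ?_
  have hz := edgePower_eq N (z + s)
  have hw := edgePower_eq N (w + s)
  have hexp : Complex.exp (-((Real.sqrt N : ℂ) + (z + s)) ^ 2 - ((Real.sqrt N : ℂ) + (w + s)) ^ 2) =
      Complex.exp (-((Real.sqrt N : ℂ) + (z + s)) ^ 2) *
        Complex.exp (-((Real.sqrt N : ℂ) + (w + s)) ^ 2) := by
    rw [← Complex.exp_add, sub_eq_add_neg]
  rw [hexp, centralRatio, edgeExpSum, edgeExpSum]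
  push_cast
  linear_combination
    (-2 * (4 ^ N * (N.factorial : ℂ) / ((2 * N).factorial : ℂ)) *
      (Complex.exp (-((Real.sqrt N : ℂ) + (z + s)) ^ 2) *
        expSum N (((Real.sqrt N : ℂ) + (z + s)) ^ 2))) * hw +
    (2 * (4 ^ N * (N.factorial : ℂ) / ((2 * N).factorial : ℂ)) *
      (Complex.exp (-((Real.sqrt N : ℂ) + (w + s)) ^ 2) *
        expSum N (((Real.sqrt N : ℂ) + (w + s)) ^ 2))) * hz

theorem tendsto_scaledPreKernel_add_ofReal (N : ℕ) (z w : ℂ) :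
    Tendsto (fun s : ℝ => scaledPreKernel N (z + s) (w + s)) atTop (𝓝 0) := by
  set a : ℂ := (Real.sqrt N : ℂ) + z
  set b : ℂ := (Real.sqrt N : ℂ) + w
  have h := (tendsto_finsetSum (Finset.range N) fun i _ =>
    (((tendsto_add_ofReal_pow_mul_exp a (2 * i + 1)).mul
      (tendsto_exp_mul_expSum_add_ofReal b (i + 1))).sub
    ((tendsto_add_ofReal_pow_mul_exp b (2 * i + 1)).mul
      (tendsto_exp_mul_expSum_add_ofReal a (i + 1)))).const_mul
    (4 ^ i * (i.factorial : ℂ) / ((2 * i + 1).factorial : ℂ))).const_mul 2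
  simp only [mul_zero, sub_zero, Finset.sum_const_zero] at h
  refine h.congr fun s => ?_
  rw [scaledPreKernel, skewSum, ← add_assoc, ← add_assoc, sub_eq_add_neg, Complex.exp_add]
  congr 1
  rw [Finset.mul_sum]
  refine Finset.sum_congr rfl fun i _ => ?_
  ring

theorem EdgeRegime.norm_deriv_le {N : ℕ} {z z₀ w w₀ : ℂ} (hz : EdgeRegime z₀ N z)
    (hw : EdgeRegime w₀ N w) (hc : centralRatio N ≤ 1) {s : ℝ} (hs : 0 ≤ s) :
    ‖2 * (centralRatio N : ℂ) * (edgePower N (w + s) * edgeExpSum N (z + s) -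
        edgePower N (z + s) * edgeExpSum N (w + s))‖ ≤
      16 * (edgeBound z₀ * edgeBound w₀) * Real.exp (-s) := by
  have hc0 : 0 ≤ centralRatio N := by unfold centralRatio; positivity
  have hz0 : 0 ≤ edgeBound z₀ := (Real.exp_pos _).le
  have hw0 : 0 ≤ edgeBound w₀ := (Real.exp_pos _).le
  have hexp : Real.exp (-s) ≤ 1 := Real.exp_le_one_iff.mpr (by linarith)
  rw [norm_mul, norm_mul, Complex.norm_ofNat, Complex.norm_real, Real.norm_of_nonneg hc0]
  calc _ ≤ 2 * 1 * (‖edgePower N (w + s)‖ * ‖edgeExpSum N (z + s)‖ +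
        ‖edgePower N (z + s)‖ * ‖edgeExpSum N (w + s)‖) := by
        gcongr
        exact (norm_sub_le _ _).trans (by rw [norm_mul, norm_mul])
    _ ≤ 2 * 1 * ((edgeBound w₀ * 1) * (4 * edgeBound z₀ * Real.exp (-s)) +
        (edgeBound z₀ * 1) * (4 * edgeBound w₀ * Real.exp (-s))) := by
        gcongr
        · exact (hw.norm_edgePower_le s).trans (by gcongr)
        · exact hz.norm_edgeExpSum_le hs
        · exact (hz.norm_edgePower_le s).trans (by gcongr)
        · exact hw.norm_edgeExpSum_le hs
    _ = _ := by ring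

theorem EdgeRegime.scaledPreKernel_eq {N : ℕ} {z z₀ w w₀ : ℂ} (hz : EdgeRegime z₀ N z)
    (hw : EdgeRegime w₀ N w) (hc : centralRatio N ≤ 1) :
    scaledPreKernel N z w = ∫ s in Set.Ioi (0 : ℝ),
      -(2 * (centralRatio N : ℂ) * (edgePower N (w + s) * edgeExpSum N (z + s) -
        edgePower N (z + s) * edgeExpSum N (w + s))) := by
  have hP := continuous_edgePower N
  have hE := continuous_edgeExpSum N
  have hint : IntegrableOn (fun s : ℝ => 2 * (centralRatio N : ℂ) *
      (edgePower N (w + s) * edgeExpSum N (z + s) -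
        edgePower N (z + s) * edgeExpSum N (w + s))) (Set.Ioi 0) := by
    refine Integrable.mono' ((integrableOn_exp_neg_Ioi 0).const_mul
      (16 * (edgeBound z₀ * edgeBound w₀))) (Continuous.aestronglyMeasurable (by fun_prop)) ?_
    refine (ae_restrict_iff' measurableSet_Ioi).mpr (ae_of_all _ fun s hs => ?_)
    exact hz.norm_deriv_le hw hc (Set.mem_Ioi.mp hs).le
  have h := integral_Ioi_of_hasDerivAt_of_tendsto' (a := 0)
    (fun s _ => hasDerivAt_scaledPreKernel N z w s) hint
    (tendsto_scaledPreKernel_add_ofReal N z w)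
  rw [integral_neg, h]
  simp

variable {ι : Type*} {l : Filter ι} {n : ι → ℕ} {z w : ι → ℂ} {z₀ w₀ : ℂ}

theorem tendsto_scaledPreKernel [l.IsCountablyGenerated] (hn : Tendsto n l atTop)
    (hz : Tendsto z l (𝓝 z₀)) (hw : Tendsto w l (𝓝 w₀)) :
    Tendsto (fun i => scaledPreKernel (n i) (z i) (w i)) l (𝓝 ((Real.sqrt Real.pi : ℂ) *
      ∫ u in Set.Iio (0 : ℝ), wronskian (edgeFun w₀) (edgeFun z₀) u)) := by
  have hlt : (Real.sqrt 2)⁻¹ < 1 := by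
    apply inv_lt_one_of_one_lt₀
    rw [Real.lt_sqrt zero_le_one]
    norm_num
  have hc : ∀ᶠ i in l, centralRatio (n i) ≤ 1 :=
    hn.eventually ((tendsto_centralRatio.eventually_lt_const hlt).mono fun _ h => h.le)
  have hcl := (Complex.continuous_ofReal.tendsto _).comp (tendsto_centralRatio.comp hn)
  have hregz := eventually_edgeRegime hn hz
  have hregw := eventually_edgeRegime hn hw
  rw [integral_wronskian, ← integral_const_mul]
  have h := tendsto_integral_filter_of_dominated_convergence
    (μ := volume.restrict (Set.Ioi (0 : ℝ))) (l := l)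
    (F := fun i (s : ℝ) => -(2 * (centralRatio (n i) : ℂ) *
      (edgePower (n i) (w i + s) * edgeExpSum (n i) (z i + s) -
        edgePower (n i) (z i + s) * edgeExpSum (n i) (w i + s))))
    (f := fun s => (Real.sqrt Real.pi : ℂ) *
      (edgeTail (w₀ + s) * edgeDensity (z₀ + s) - edgeTail (z₀ + s) * edgeDensity (w₀ + s)))
    (fun s => 16 * (edgeBound z₀ * edgeBound w₀) * Real.exp (-s))
    (Eventually.of_forall fun i => by
      have hP := continuous_edgePower (n i)
      have hE := continuous_edgeExpSum (n i)
      exact Continuous.aestronglyMeasurable (by fun_prop))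
    (by
      filter_upwards [hregz, hregw, hc] with i h1 h2 h3
      refine (ae_restrict_iff' measurableSet_Ioi).mpr (ae_of_all _ fun s hs => ?_)
      rw [norm_neg]
      exact h1.norm_deriv_le h2 h3 (Set.mem_Ioi.mp hs).le)
    ((integrableOn_exp_neg_Ioi 0).const_mul _)
    (ae_of_all _ fun s => ?_)
  · refine h.congr' ?_
    filter_upwards [hregz, hregw, hc] with i h1 h2 h3
    exact (h1.scaledPreKernel_eq h2 h3).symm
  · have hzs := hz.add_const (s : ℂ)
    have hws := hw.add_const (s : ℂ)
    have hlim := ((hcl.const_mul 2).mul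
      (((tendsto_edgePower hn hws).mul (tendsto_edgeExpSum hn hzs)).sub
        ((tendsto_edgePower hn hzs).mul (tendsto_edgeExpSum hn hws)))).neg
    have h2 : (Real.sqrt 2 : ℂ) ≠ 0 :=
      Complex.ofReal_ne_zero.mpr (Real.sqrt_pos.mpr zero_lt_two).ne'
    have hpi : (Real.sqrt Real.pi : ℂ) ≠ 0 :=
      Complex.ofReal_ne_zero.mpr (Real.sqrt_pos.mpr Real.pi_pos).ne'
    have h22 : (Real.sqrt 2 : ℂ) ^ 2 = 2 := by rw [ofReal_sqrt_sq zero_le_two]; simp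
    convert! hlim using 2
    rw [edgeDensity, edgeDensity]
    push_cast
    field_simp
    rw [h22]
    ring

end PreKernel

/-! ### The micro-scale and the rescaled correlation functions -/

section Rescaling

open Polynomial

theorem quarterLaplacian_gaussianPotential (ζ : ℂ) : quarterLaplacian gaussianPotential ζ = 1 := by
  have h1 : fderiv ℝ gaussianPotential =
      fun x : ℂ => ((2 : ℝ) • innerSL ℝ : ℂ →L[ℝ] ℂ →L[ℝ] ℝ) x := by
    funext x
    unfold gaussianPotential
    rw [fderiv_norm_sq_apply]
    simp [two_smul]
  have h2 : ∀ m : Fin 2 → ℂ,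
      iteratedFDeriv ℝ 2 gaussianPotential ζ m = 2 * inner ℝ (m 0) (m 1) := by
    intro m
    rw [iteratedFDeriv_two_apply, h1, ContinuousLinearMap.fderiv]
    rfl
  rw [quarterLaplacian, InnerProductSpace.laplacian_eq_iteratedFDeriv_orthonormalBasis _
    Complex.orthonormalBasisOneI]
  simp only [h2, Fin.sum_univ_two]
  simp
  norm_num

theorem IsMicroScale.sq_mul_eq {p : ℂ} {N : ℕ} (hN : 0 < N) {r : ℝ}
    (h : IsMicroScale gaussianPotential p N r) : r ^ 2 * N = 2 := by
  obtain ⟨hr, h⟩ := h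
  have hN' : (N : ℝ) ≠ 0 := Nat.cast_ne_zero.mpr hN.ne'
  have hvol : areaMeasure.real (Metric.ball p r) = r ^ 2 := by
    rw [areaMeasure, measureReal_nnreal_smul_apply, measureReal_def, Complex.volume_ball]
    simp [hr.le]
    field_simp
  simp only [quarterLaplacian_gaussianPotential] at h
  rw [setIntegral_const, hvol, smul_eq_mul] at h
  field_simp at h
  linarith

theorem eval_evenSkewPoly {N : ℕ} (hN : 0 < N) (i : ℕ) (x : ℂ) :
    (evenSkewPoly N i).eval x =
      (i.factorial : ℂ) * (2 / N) ^ i * expSum (i + 1) (N * x ^ 2 / 2) := by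
  have hN' : (N : ℂ) ≠ 0 := Nat.cast_ne_zero.mpr hN.ne'
  induction i with
  | zero => simp [evenSkewPoly, expSum]
  | succ i ih =>
    have hf : (i.factorial : ℂ) ≠ 0 := Nat.cast_ne_zero.mpr i.factorial_ne_zero
    have hi : (i : ℂ) + 1 ≠ 0 := Nat.cast_add_one_ne_zero i
    rw [evenSkewPoly, expSum_succ]
    simp only [eval_add, eval_pow, eval_X, eval_mul, eval_C, ih]
    rw [Nat.factorial_succ, div_pow, div_pow, div_pow, mul_pow, ← pow_mul, pow_succ (2 : ℂ),
      pow_succ (N : ℂ) i]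
    push_cast
    field_simp
    ring

theorem wedgeKernel_smul {N : ℕ} (hN : 0 < N) {τ : ℂ} (hτ : τ ^ 2 * N = 2) (a b : ℂ) :
    wedgeKernel N (τ * a) (τ * b) = -τ * (N : ℂ) ^ 2 * skewSum N a b := by
  have hN' : (N : ℂ) ≠ 0 := Nat.cast_ne_zero.mpr hN.ne'
  have hτ' : τ ^ 2 = 2 / N := by field_simp; exact hτ
  have harg : ∀ c : ℂ, (N : ℂ) * (τ * c) ^ 2 / 2 = c ^ 2 := fun c => by
    rw [mul_pow, hτ']; field_simp
  have hodd : ∀ (c : ℂ) (i : ℕ), (τ * c) ^ (2 * i + 1) = τ * (2 / N) ^ i * c ^ (2 * i + 1) :=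
    fun c i => by rw [mul_pow, pow_succ τ, pow_mul τ, hτ']; ring
  rw [wedgeKernel, skewSum, ← Fin.sum_univ_eq_sum_range (fun i =>
    (4 ^ i * (i.factorial : ℂ) / ((2 * i + 1).factorial : ℂ)) *
    (a ^ (2 * i + 1) * expSum (i + 1) (b ^ 2) - b ^ (2 * i + 1) * expSum (i + 1) (a ^ 2))),
    Finset.mul_sum]
  refine Finset.sum_congr rfl fun i _ => ?_
  have hf : ((2 * (i : ℕ) + 1).factorial : ℂ) ≠ 0 := Nat.cast_ne_zero.mpr (Nat.factorial_ne_zero _)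
  simp only [skewPoly, if_true, one_ne_zero, if_false, eval_evenSkewPoly hN, eval_pow, eval_X, harg,
    hodd, skewNorm]
  rw [show (4 : ℂ) = 2 ^ 2 by norm_num, ← pow_mul, div_pow, pow_add (N : ℂ), pow_mul (N : ℂ)]
  field_simp
  ring

theorem pfaffian_scale {k : ℕ} (c : ℂ) (g : Fin k × Fin 2 → ℂ)
    (A : Fin k × Fin 2 → Fin k × Fin 2 → ℂ) :
    pfaffian (Matrix.of fun a b => c * (g a * g b) * A a b) =
      c ^ k * (∏ j, g (j, 0) * g (j, 1)) * pfaffian (Matrix.of A) := by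
  have hg : ∀ σ : Equiv.Perm (Fin k × Fin 2),
      ∏ j, g (σ (j, 0)) * g (σ (j, 1)) = ∏ j, g (j, 0) * g (j, 1) := by
    intro σ
    have h := Equiv.prod_comp σ g
    rw [Fintype.prod_prod_type, Fintype.prod_prod_type] at h
    simpa only [Fin.prod_univ_two] using h
  unfold pfaffian
  simp only [Matrix.of_apply]
  rw [mul_left_comm (c ^ k * _)]
  refine congrArg _ ?_
  rw [Finset.mul_sum]
  refine Finset.sum_congr rfl fun σ _ => ?_
  rw [Finset.prod_mul_distrib, Finset.prod_mul_distrib, hg, Finset.prod_const, Finset.card_univ,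
    Fintype.card_fin]
  ring

/-- The rescaled correlation function at the edge point `√2 ε`, `ε = ±1`. The oscillating factors
that distinguish `e^{-|√N + z|²}` from `e^{-(√N + z)²}` are opposite at `z` and `conj z`, and
therefore drop out of the Pfaffian. -/
theorem rescaledCorrelation_eq {N k : ℕ} (hN : 0 < N) (hk : k ≤ N) {p : ℂ} {θ r : ℝ} {ε : ℝ}
    (hε : ε ^ 2 = 1) (hp : p = ε * (Real.sqrt 2 : ℂ)) (hθ : Complex.exp (θ * Complex.I) = ε)
    (hr0 : 0 < r) (hr : r ^ 2 * N = 2) (z : Fin k → ℂ) :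
    (rescaledCorrelation gaussianPotential p θ r N k z : ℂ) =
      (∏ j, (conj (z j) - z j)) * pfaffian (Matrix.of fun a b =>
        Complex.exp (-(‖z a.1‖ : ℂ) ^ 2 - (‖z b.1‖ : ℂ) ^ 2) *
          Complex.exp (conjPairs z a ^ 2 + conjPairs z b ^ 2) *
            scaledPreKernel N (conjPairs z a) (conjPairs z b)) := by
  have hN' : (0 : ℝ) < N := Nat.cast_pos.mpr hN
  set q : ℝ := Real.sqrt N with hq
  have hq0 : 0 < q := Real.sqrt_pos.mpr hN'
  have hqq : q ^ 2 = N := Real.sq_sqrt hN'.le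
  have hrq : r * q = Real.sqrt 2 := by
    rw [← Real.sqrt_sq (mul_pos hr0 hq0).le, mul_pow, hqq, hr]
  set τ : ℝ := ε * r with hτ
  have hτ2 : (τ : ℂ) ^ 2 * N = 2 := by
    have : τ ^ 2 * N = 2 := by rw [hτ, mul_pow, hε, one_mul, hr]
    exact_mod_cast this
  set ζ : Fin k → ℂ := fun j => p + Complex.exp (θ * Complex.I) * r * z j with hζ
  have hζ' : ∀ j, ζ j = τ * (q + z j) := by
    intro j
    simp only [hζ, hθ, hp, hτ, ← hrq]
    push_cast
    ring
  have hpairs : ∀ a, conjPairs ζ a = τ * (q + conjPairs z a) := by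
    rintro ⟨j, s⟩
    fin_cases s
    · simp [hζ']
    · simp [hζ']
  have hweight : ∀ j, skewWeight N (ζ j) =
      -τ * (conj (z j) - z j) * (Real.exp (-(2 * ‖(q : ℂ) + z j‖ ^ 2)) : ℂ) := by
    intro j
    have hn : (N : ℝ) * ‖ζ j‖ ^ 2 = 2 * ‖(q : ℂ) + z j‖ ^ 2 := by
      rw [hζ', norm_mul, mul_pow, Complex.norm_real, Real.norm_eq_abs, sq_abs, hτ, mul_pow, hε,
        one_mul, ← mul_assoc, mul_comm (N : ℝ), hr]
    rw [skewWeight, gaussianPotential, hn, hζ']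
    simp only [map_mul, map_add, Complex.conj_ofReal]
    ring
  set g : Fin k × Fin 2 → ℂ := fun a =>
    Complex.exp (-(‖z a.1‖ : ℂ) ^ 2 + conjPairs z a ^ 2 - ((q : ℂ) + conjPairs z a) ^ 2) with hg
  have hgg : ∀ j, g (j, 0) * g (j, 1) = (Real.exp (-(2 * ‖(q : ℂ) + z j‖ ^ 2)) : ℂ) := by
    intro j
    have hn1 : (‖z j‖ : ℂ) ^ 2 = z j * conj (z j) := (Complex.mul_conj' _).symm
    have hn2 : (‖(q : ℂ) + z j‖ : ℂ) ^ 2 = (q + z j) * (q + conj (z j)) := by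
      rw [← Complex.mul_conj', map_add, Complex.conj_ofReal]
    simp only [hg, conjPairs_zero, conjPairs_one]
    rw [← Complex.exp_add]
    push_cast
    rw [hn1, hn2]
    congr 1
    ring
  have hmat : ∀ a b, Complex.exp (-(‖z a.1‖ : ℂ) ^ 2 - (‖z b.1‖ : ℂ) ^ 2) *
          Complex.exp (conjPairs z a ^ 2 + conjPairs z b ^ 2) *
            scaledPreKernel N (conjPairs z a) (conjPairs z b) =
      2 * (g a * g b) * skewSum N (q + conjPairs z a) (q + conjPairs z b) := by
    intro a b
    simp only [hg, scaledPreKernel]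
    rw [← Complex.exp_add, ← Complex.exp_add, ← hq]
    rw [mul_left_comm, ← mul_assoc (Complex.exp _), ← Complex.exp_add, ← mul_assoc]
    ring_nf
  have hwedge : ∀ a b, wedgeKernel N (conjPairs ζ a) (conjPairs ζ b) =
      (-τ * (N : ℂ) ^ 2) * (1 * 1) * skewSum N (q + conjPairs z a) (q + conjPairs z b) := by
    intro a b
    rw [hpairs, hpairs, wedgeKernel_smul hN hτ2]
    ring
  have hscale := pfaffian_scale (-τ * (N : ℂ) ^ 2) (fun _ => 1)
    (fun a b => skewSum N (q + conjPairs z a) (q + conjPairs z b))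
  simp only [hmat]
  rw [pfaffian_scale, rescaledCorrelation]
  push_cast
  rw [correlation_eq_pfaffian hN hk ζ]
  simp only [hwedge]
  rw [hscale]
  simp only [hweight, hgg, mul_one, Finset.prod_const_one, Finset.prod_mul_distrib,
    Finset.prod_const, Finset.card_univ, Fintype.card_fin]
  -- The factors `r²`, `-τ`, `1/2` and `-τ N²` of one particle multiply to `r² τ² N² / 2 = 2`.
  have hconst : (r : ℂ) ^ (2 * k) * (-(τ : ℂ)) ^ k * (1 / 2) ^ k * (-τ * (N : ℂ) ^ 2) ^ k =
      2 ^ k := by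
    rw [pow_mul, ← mul_pow, ← mul_pow, ← mul_pow]
    congr 1
    have hr' : (r : ℂ) ^ 2 * N = 2 := by exact_mod_cast hr
    linear_combination (1 / 2 * (r : ℂ) ^ 2 * N) * hτ2 + hr'
  rw [← hconst]
  ring

end Rescaling

/-! ### Continuous convergence and the edge limit -/

section ContinuousConvergence

/-- Continuous convergence implies locally uniform convergence; the continuity of the limit
is part of the conclusion and need not be assumed. -/
theorem tendstoUniformlyOn_of_continuousConvergence {ι X : Type*} [TopologicalSpace X]
    {l : Filter ι} [l.NeBot] {F : ι → X → ℂ} {f : X → ℂ}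
    (h : ∀ x, Tendsto (fun q : ι × X => F q.1 q.2) (l ×ˢ 𝓝 x) (𝓝 (f x)))
    {S : Set X} (hS : IsCompact S) : TendstoUniformlyOn F f l S := by
  have hpt : ∀ x, Tendsto (fun i => F i x) l (𝓝 (f x)) := fun x =>
    (h x).comp (tendsto_id.prodMk (tendsto_const_nhds))
  refine (tendstoLocallyUniformlyOn_iff_tendstoUniformlyOn_of_compact hS).mp ?_
  refine TendstoLocallyUniformly.tendstoLocallyUniformlyOn ?_
  rw [tendstoLocallyUniformly_iff_filter]
  intro x
  rw [Metric.tendstoUniformlyOnFilter_iff]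
  intro ε hε
  have h1 : ∀ᶠ q : ι × X in l ×ˢ 𝓝 x, dist (F q.1 q.2) (f x) < ε / 2 :=
    Metric.tendsto_nhds.mp (h x) _ (half_pos hε)
  have h2 : ∀ᶠ y in 𝓝 x, dist (f y) (f x) ≤ ε / 2 := by
    rw [prod_comm, eventually_map] at h1
    filter_upwards [h1.curry] with y hy
    exact le_of_tendsto ((hpt y).dist tendsto_const_nhds) (hy.mono fun i hi => hi.le)
  filter_upwards [h1, h2.prod_inr l] with q hq1 hq2
  calc dist (f q.2) (F q.1 q.2) ≤ dist (f q.2) (f x) + dist (F q.1 q.2) (f x) :=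
        dist_triangle_right _ _ _
    _ < ε := by linarith

theorem edgeKernel_apply {k : ℕ} (z : Fin k → ℂ) (a b : Fin k × Fin 2) :
    edgeKernel (z a.1) (z b.1) a.2 b.2 =
      Complex.exp (-(‖z a.1‖ : ℂ) ^ 2 - (‖z b.1‖ : ℂ) ^ 2) *
        edgePreKernel (conjPairs z a) (conjPairs z b) := by
  obtain ⟨i, s⟩ := a
  obtain ⟨j, t⟩ := b
  fin_cases s <;> fin_cases t <;> simp [edgeKernel]

theorem tendsto_rescaledCorrelation {k : ℕ} {p : ℂ} {θ ε : ℝ} {r : ℕ → ℝ} (hε : ε ^ 2 = 1)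
    (hp : p = ε * (Real.sqrt 2 : ℂ)) (hθ : Complex.exp (θ * Complex.I) = ε)
    (hr : ∀ N : ℕ, 1 ≤ N → IsMicroScale gaussianPotential p N (r N)) (z : Fin k → ℂ) :
    Tendsto (fun q : ℕ × (Fin k → ℂ) =>
      (rescaledCorrelation gaussianPotential p θ (r q.1) q.1 k q.2 : ℂ)) (atTop ×ˢ 𝓝 z)
      (𝓝 (edgeCorrelation k z)) := by
  have hn : Tendsto (fun q : ℕ × (Fin k → ℂ) => q.1) (atTop ×ˢ 𝓝 z) atTop := tendsto_fst
  have hz : Tendsto (fun q : ℕ × (Fin k → ℂ) => q.2) (atTop ×ˢ 𝓝 z) (𝓝 z) := tendsto_snd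
  have hzj : ∀ j, Tendsto (fun q : ℕ × (Fin k → ℂ) => q.2 j) (atTop ×ˢ 𝓝 z) (𝓝 (z j)) := fun j =>
    ((continuous_apply j).tendsto z).comp hz
  have hconj : ∀ j, Tendsto (fun q : ℕ × (Fin k → ℂ) => conj (q.2 j)) (atTop ×ˢ 𝓝 z)
      (𝓝 (conj (z j))) := fun j => (Complex.continuous_conj.tendsto _).comp (hzj j)
  have hnorm : ∀ j, Tendsto (fun q : ℕ × (Fin k → ℂ) => (‖q.2 j‖ : ℂ)) (atTop ×ˢ 𝓝 z)
      (𝓝 (‖z j‖ : ℂ)) := fun j => (Complex.continuous_ofReal.tendsto _).comp (hzj j).norm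
  have hpair : ∀ a : Fin k × Fin 2, Tendsto (fun q : ℕ × (Fin k → ℂ) => conjPairs q.2 a)
      (atTop ×ˢ 𝓝 z) (𝓝 (conjPairs z a)) := by
    rintro ⟨j, s⟩
    fin_cases s
    · simpa using hzj j
    · simpa using hconj j
  have hentry : ∀ a b : Fin k × Fin 2, Tendsto (fun q : ℕ × (Fin k → ℂ) =>
      Complex.exp (-(‖q.2 a.1‖ : ℂ) ^ 2 - (‖q.2 b.1‖ : ℂ) ^ 2) *
          Complex.exp (conjPairs q.2 a ^ 2 + conjPairs q.2 b ^ 2) *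
            scaledPreKernel q.1 (conjPairs q.2 a) (conjPairs q.2 b)) (atTop ×ˢ 𝓝 z)
      (𝓝 (edgeKernel (z a.1) (z b.1) a.2 b.2)) := by
    intro a b
    have h1 := (((hnorm a.1).pow 2).neg.sub ((hnorm b.1).pow 2)).cexp
    have h2 := (((hpair a).pow 2).add ((hpair b).pow 2)).cexp
    have h3 := (h1.mul h2).mul (tendsto_scaledPreKernel hn (hpair a) (hpair b))
    convert! h3 using 2
    rw [edgeKernel_apply, edgePreKernel]
    ring
  have hlim : Tendsto (fun q : ℕ × (Fin k → ℂ) => (∏ j, (conj (q.2 j) - q.2 j)) *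
      pfaffian (Matrix.of fun a b =>
        Complex.exp (-(‖q.2 a.1‖ : ℂ) ^ 2 - (‖q.2 b.1‖ : ℂ) ^ 2) *
          Complex.exp (conjPairs q.2 a ^ 2 + conjPairs q.2 b ^ 2) *
            scaledPreKernel q.1 (conjPairs q.2 a) (conjPairs q.2 b))) (atTop ×ˢ 𝓝 z)
      (𝓝 (edgeCorrelation k z)) := by
    refine (tendsto_finsetProd _ fun j _ => (hconj j).sub (hzj j)).mul ?_
    exact (tendsto_finsetSum _ fun σ _ =>
      (tendsto_finsetProd _ fun j _ => hentry (σ (j, 0)) (σ (j, 1))).const_mul _).const_mul _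
  refine hlim.congr' ?_
  filter_upwards [hn.eventually_ge_atTop 1, hn.eventually_ge_atTop k] with q h1 h2
  exact (rescaledCorrelation_eq h1 h2 hε hp hθ (hr q.1 h1).1 ((hr q.1 h1).sq_mul_eq h1) q.2).symm

end ContinuousConvergence

end SymplecticGinibre

open SymplecticGinibre
/-- Edge scaling limit of the symplectic Ginibre ensemble at the real edge points `p = ± √2`.
The droplet is the disc of radius `√2` about `0`, so that the outer unit normal at `p` is
`p / √2 = e^{iθ}`; `r N` is the micro-scale at `p`. -/
theorem theorem2p1
    (p : ℂ) (hp : p = (Real.sqrt 2 : ℂ) ∨ p = -(Real.sqrt 2 : ℂ))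
    (θ : ℝ) (hθ : Complex.exp (θ * Complex.I) = p / (Real.sqrt 2 : ℂ))
    (r : ℕ → ℝ) (hr : ∀ N : ℕ, 1 ≤ N → IsMicroScale gaussianPotential p N (r N)) :
    (∀ z w : ℂ, IntegrableOn (wronskian (edgeFun w) (edgeFun z)) (Set.Iio (0 : ℝ))) ∧
    ∀ (k : ℕ) (S : Set (Fin k → ℂ)), IsCompact S →
      TendstoUniformlyOn
        (fun (N : ℕ) (z : Fin k → ℂ) =>
          (rescaledCorrelation gaussianPotential p θ (r N) N k z : ℂ))
        (edgeCorrelation k) atTop S := by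
  have h2 : (Real.sqrt 2 : ℂ) ≠ 0 :=
    Complex.ofReal_ne_zero.mpr (Real.sqrt_pos.mpr zero_lt_two).ne'
  obtain ⟨ε, hε, hpε⟩ : ∃ ε : ℝ, ε ^ 2 = 1 ∧ p = ε * (Real.sqrt 2 : ℂ) := by
    rcases hp with rfl | rfl
    · exact ⟨1, by norm_num, by simp⟩
    · exact ⟨-1, by norm_num, by simp⟩
  have hθε : Complex.exp (θ * Complex.I) = ε := by
    rw [hθ, hpε, mul_div_cancel_right₀ _ h2]
  exact ⟨integrableOn_wronskian, fun k S hS => tendstoUniformlyOn_of_continuousConvergence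
    (fun z => tendsto_rescaledCorrelation hε hpε hθε hr z) hS⟩
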